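/- For $n\ge 1$ let $B_n=\langle \sigma_1,\dots,\sigma_{n-1}\mid \sigma_i\sigma_j=\sigma_j\sigma_i\ (|i-j|\ge 2),\ \sigma_i\sigma_j\sigma_i=\sigma_j\sigma_i\sigma_j\ (|i-j|=1)\rangle$ be Artin's braid group, with $B_{n-1}\subset B_n$ via $\sigma_i\mapsto\sigma_i$. For $1\le p<q\le n$ put $a_{p,q}=\sigma_p\cdots\sigma_{q-2}\,\sigma_{q-1}\,\sigma_{q-2}^{-1}\cdots\sigma_p^{-1}$, let $\mathrm{BKL}_n$ (the dual braid monoid) be the submonoid of $B_n$ generated by these elements, let $\Delta_n=a_{1,2}a_{2,3}\cdots a_{n-1,n}=\sigma_1\cdots\sigma_{n-1}$, and let $\varphi_n(\beta)=\Delta_n\beta\Delta_n^{-1}$. For $n\ge3$, the $\mathrm{BKL}_{n-1}$-tail of $\beta\in\mathrm{BKL}_n$ is the maximal right-divisor of $\beta$ (for right-divisibility in $\mathrm{BKL}_n$) that lies in $\mathrm{BKL}_{n-1}$. The $\varphi_n$-splitting of a nontrivial $\beta\in\mathrm{BKL}_n$ is the unique sequence $(\beta_r,\dots,\beta_1)$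 in $\mathrm{BKL}_{n-1}$ such that $\beta_r\ne1$, $\beta=\varphi_n^{r-1}(\beta_r)\cdots\varphi_n(\beta_2)\,\beta_1$ and, for each $k\ge1$, the $\mathrm{BKL}_{n-1}$-tail of $\varphi_n^{r-k}(\beta_r)\cdots\varphi_n(\beta_{k+1})$ is trivial; the splitting of $1$ is the length one sequence $(1)$. The length $r$ is the $n$-breadth of $\beta$. The ordering $<^*$ on $\mathrm{BKL}_n$ ($n\ge2$) is defined recursively: on $\mathrm{BKL}_2$, $a_{1,2}^i<^*a_{1,2}^j$ if and only if $i<j$; for $n\ge3$ and $\beta,\gamma\in\mathrm{BKL}_n$, $\beta<^*\gamma$ if and only if the $\varphi_n$-splitting of $\beta$ is smaller than that of $\gamma$ for the ShortLex-extension of the ordering $<^*$ of $\mathrm{BKL}_{n-1}$ (compare lengths first and then, for equal lengths, lexicographically from the left). For $n\ge3$ and $p\ge1$ let $\delta_{n,p}=\varphi_n^{p+1}(a_{n-2,n-1})\cdot\varphi_n^{p}(a_{n-2,n-1})\cdots\varphi_n^2(a_{n-2,n-1})$. **Proposition.** For all $n\ge3$ and $p\ge1$: (i) the $\varphi_n$-splitting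 of $\delta_{n,p}$ is the sequence $(a_{n-2,n-1},\dots,a_{n-2,n-1},1,1)$ of length $p+2$; (ii) $\delta_{n,p}=\Delta_n^{p}\,\Delta_{n-1}^{-p}$; (iii) $\delta_{n,p}$ is the $<^*$-smallest braid in $\mathrm{BKL}_n$ that has $n$-breadth $p+2$; moreover, it is the least upper bound, in $(\mathrm{BKL}_n,<^*)$, of the set of all braids of $\mathrm{BKL}_n$ of $n$-breadth at most $p+1$. -/

import Mathlib

namespace DualBraid

/-- The indices `1, …, n - 1` of the Artin generators of the `n`-strand braid group. -/
abbrev Idx (n : ℕ) : Type := {i : ℕ // 1 ≤ i ∧ i < n}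

/-- Artin's relators: `σᵢ σⱼ = σⱼ σᵢ` for `|i - j| ≥ 2` and `σᵢ σⱼ σᵢ = σⱼ σᵢ σⱼ` for
`|i - j| = 1`. -/
def artinRels (n : ℕ) : Set (FreeGroup (Idx n)) :=
  {r | ∃ i j : Idx n, (i.1 + 2 ≤ j.1 ∨ j.1 + 2 ≤ i.1) ∧
      r = (FreeGroup.of i * FreeGroup.of j) * (FreeGroup.of j * FreeGroup.of i)⁻¹} ∪
  {r | ∃ i j : Idx n, (i.1 + 1 = j.1 ∨ j.1 + 1 = i.1) ∧
      r = (FreeGroup.of i * FreeGroup.of j * FreeGroup.of i) *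
        (FreeGroup.of j * FreeGroup.of i * FreeGroup.of j)⁻¹}

/-- Artin's braid group `Bₙ` on `n` strands. -/
abbrev B (n : ℕ) : Type := PresentedGroup (artinRels n)

/-- The generator `σᵢ` of `Bₙ`, for `1 ≤ i < n` (and `1` for an index out of this range). -/
def σ (n i : ℕ) : B n :=
  if h : 1 ≤ i ∧ i < n then PresentedGroup.of ⟨i, h⟩ else 1

/-- The index `i` seen as an index for one more strand. -/
def Idx.up {n : ℕ} (i : Idx (n - 1)) : Idx n :=
  ⟨i.1, i.2.1, lt_of_lt_of_le i.2.2 (Nat.sub_le n 1)⟩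

theorem incl_rels (n : ℕ) : ∀ r ∈ artinRels (n - 1),
    FreeGroup.lift (fun i : Idx (n - 1) => (PresentedGroup.of i.up : B n)) r = 1 := by
  rintro r (⟨i, j, hij, rfl⟩ | ⟨i, j, hij, rfl⟩)
  · have h : (PresentedGroup.mk (artinRels n))
        ((FreeGroup.of i.up * FreeGroup.of j.up) * (FreeGroup.of j.up * FreeGroup.of i.up)⁻¹)
        = 1 := PresentedGroup.one_of_mem (Or.inl ⟨i.up, j.up, hij, rfl⟩)
    simpa [PresentedGroup.of] using h
  · have h : (PresentedGroup.mk (artinRels n))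
        ((FreeGroup.of i.up * FreeGroup.of j.up * FreeGroup.of i.up) *
          (FreeGroup.of j.up * FreeGroup.of i.up * FreeGroup.of j.up)⁻¹)
        = 1 := PresentedGroup.one_of_mem (Or.inr ⟨i.up, j.up, hij, rfl⟩)
    simpa [PresentedGroup.of] using h

/-- The canonical embedding `Bₙ₋₁ → Bₙ`, `σᵢ ↦ σᵢ` (adding an unbraided last strand). -/
def incl (n : ℕ) : B (n - 1) →* B n :=
  PresentedGroup.toGroup (incl_rels n)

/-- `σₚ σₚ₊₁ ⋯ σ_{q-1}` in `Bₙ`; it is `1` for `q ≤ p`. -/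
def sigmaProd (n p q : ℕ) : B n := ((List.Ico p q).map (σ n)).prod

/-- The Birman–Ko–Lee generator
`a_{p,q} = σₚ ⋯ σ_{q-2} · σ_{q-1} · σ_{q-2}⁻¹ ⋯ σₚ⁻¹` of `Bₙ`, for `1 ≤ p < q ≤ n`. -/
def a (n p q : ℕ) : B n :=
  sigmaProd n p (q - 1) * σ n (q - 1) * (sigmaProd n p (q - 1))⁻¹

/-- The dual braid monoid `BKLₙ`, a submonoid of `Bₙ`. -/
def BKL (n : ℕ) : Submonoid (B n) :=
  Submonoid.closure {x | ∃ p q : ℕ, 1 ≤ p ∧ p < q ∧ q ≤ n ∧ x = a n p q}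

/-- The Garside element `Δₙ = a_{1,2} a_{2,3} ⋯ a_{n-1,n}` of `BKLₙ`. -/
def Δ (n : ℕ) : B n := ((List.Ico 1 n).map fun i => a n i (i + 1)).prod

/-- The Garside automorphism `φₙ : β ↦ Δₙ β Δₙ⁻¹`. -/
def φ (n : ℕ) : MulAut (B n) := MulAut.conj (Δ n)

/-- `x` right-divides `y` in `BKLₙ`. -/
def RightDvd (n : ℕ) (x y : B n) : Prop := ∃ z ∈ BKL n, y = z * x

/-- `t` is the `BKLₙ₋₁`-tail of `x`: the maximal right-divisor of `x` that lies in `BKLₙ₋₁`. -/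
def IsTail (n : ℕ) (x : B n) (t : B (n - 1)) : Prop :=
  t ∈ BKL (n - 1) ∧ RightDvd n (incl n t) x ∧
    ∀ u ∈ BKL (n - 1), RightDvd n (incl n u) x → RightDvd n (incl n u) (incl n t)

/-- For a sequence `(β_r, …, β₁)` in `Bₙ₋₁`, the product
`φₙ^{r-1}(β_r) ⋯ φₙ(β₂) · β₁` in `Bₙ`. -/
def splitProd (n : ℕ) : List (B (n - 1)) → B n
  | [] => 1
  | b :: s => (φ n ^ s.length) (incl n b) * splitProd n s

/-- The sequence `s = (β_r, …, β₁)` is the `φₙ`-splitting of the braid `β` of `BKLₙ`.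
The entries lie in `BKLₙ₋₁`, the product `φₙ^{r-1}(β_r) ⋯ φₙ(β₂) · β₁` is `β`, for each `k ≥ 1` the
`BKLₙ₋₁`-tail of `φₙ^{r-k}(β_r) ⋯ φₙ(β_{k+1})` is trivial, and `β_r ≠ 1`.
The sequence is nonempty and the last condition is not imposed when `r = 1`, so that the
splitting of each `β` in `BKLₙ₋₁`, including `β = 1`, is the length one sequence `(β)`. -/
def IsSplitting (n : ℕ) (β : B n) (s : List (B (n - 1))) : Prop :=
  β ∈ BKL n ∧ s ≠ [] ∧ (∀ b ∈ s, b ∈ BKL (n - 1)) ∧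
  (2 ≤ s.length → s.head? ≠ some 1) ∧
  β = splitProd n s ∧
  ∀ k : ℕ, 1 ≤ k → k ≤ s.length → IsTail n (φ n (splitProd n (s.take (s.length - k)))) 1

/-- `β` is a braid of `BKLₙ` with `n`-breadth `r`, i.e. its `φₙ`-splitting has length `r`. -/
def HasBreadth (n : ℕ) (β : B n) (r : ℕ) : Prop :=
  ∃ s, IsSplitting n β s ∧ s.length = r

/-- The rotating ordering `<*` on `BKLₙ`, for `n ≥ 2`. On `BKL₂` it is the ordering of the exponents
of `a_{1,2}`; on `BKLₙ`, `n ≥ 3`, it compares `φₙ`-splittings by the ShortLex-extension of the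
ordering of `BKLₙ₋₁` (length first, then lexicographically from the left). -/
def RotLT : (n : ℕ) → B n → B n → Prop
  | 0, _, _ => False
  | 1, _, _ => False
  | 2, β, γ => ∃ i j : ℕ, i < j ∧ β = a 2 1 2 ^ i ∧ γ = a 2 1 2 ^ j
  | m + 3, β, γ => ∃ s t : List (B (m + 2)),
      IsSplitting (m + 3) β s ∧ IsSplitting (m + 3) γ t ∧ List.Shortlex (RotLT (m + 2)) s t

/-- `β ≤* γ`. -/
def RotLE (n : ℕ) (β γ : B n) : Prop := RotLT n β γ ∨ β = γ

/-- The separator `δ_{n,p} = φₙ^{p+1}(a_{n-2,n-1}) ⋯ φₙ²(a_{n-2,n-1})`, for `n ≥ 3`, `p ≥ 1`. -/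
def sep (n p : ℕ) : B n :=
  ((List.range p).reverse.map fun j => (φ n ^ (j + 2)) (a n (n - 2) (n - 1))).prod

end DualBraid

/-!
The braids that right-divide `Δₙ` in `BKLₙ` correspond to the noncrossing permutations of
`{1, …, n}`. Below the cycle `(1 2 … n)` these form a lattice under refinement, and the residues
`(s ⊔ t) s⁻¹` satisfy the cube law. Words in the noncrossing permutations thus have least common
left-multiples that can be computed letter by letter, and the monoid they form is cancellative and
embeds into its group of fractions. As `Bₙ` maps to that group, two words represent the same braid
if and only if they are equal in the monoid, so that right-divisibility in `BKLₙ` becomes a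
computation with residues.

The letters of the word `φₙ^{j+k}(a_{n-2,n-1}) ⋯ φₙ^j(a_{n-2,n-1})` are transpositions such that no
two consecutive ones multiply to a noncrossing permutation. A generator that does not divide the
last letter therefore does not divide the braid, which shows that the tails in the splitting of the
separator are trivial. Conversely, the triviality of the tails in the splitting of a braid of
breadth `p + 2` forces each of its first `p` entries to be nontrivial and right-divisible by some
`a_{q,n-1}`. Among such braids `a_{n-2,n-1}` is the least, so that the separator is minimal. It is a
least upper bound since the last entry of a splitting can be increased without changing the breadth.
-/

namespace DualBraid

/-! ### Noncrossing permutations -/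

open Equiv

section NoncrossingPermutations

/-- `j` lies strictly inside the arc that runs cyclically upwards from `i` to `x`; the arc from `i`
to `i` is understood as the full circle. -/
def InGap (i x j : ℕ) : Prop := (i < x ∧ i < j ∧ j < x) ∨ (x ≤ i ∧ (i < j ∨ j < x))

/-- No arc `k → t k` separates `i` from `j`. If `t` is noncrossing, this means that `i` and `j` lie
in the same cycle of `t`. -/
def SameBlock (t : Perm ℕ) (i j : ℕ) : Prop := ∀ k, InGap k (t k) i ↔ InGap k (t k) j

/-- `s` preserves the blocks of `t`. On noncrossing permutations this is the refinement order of
noncrossing partitions. -/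
def Refines (s t : Perm ℕ) : Prop := ∀ j, SameBlock t j (s j)

/-- The cycles of `t` are cyclically increasing and pairwise noncrossing, so that `t` encodes a
noncrossing partition. -/
def Noncrossing (t : Perm ℕ) : Prop := Refines t t

variable {i j l n : ℕ} {r s t u v w : Perm ℕ}

theorem SameBlock.refl (t : Perm ℕ) (i : ℕ) : SameBlock t i i := fun _ => Iff.rfl

theorem SameBlock.symm (h : SameBlock t i j) : SameBlock t j i := fun k => (h k).symm

theorem SameBlock.trans (h : SameBlock t i j) (h' : SameBlock t j l) : SameBlock t i l :=
  fun k => (h k).trans (h' k)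

theorem SameBlock.lt_apply (h : SameBlock t i j) (hij : i < j) : i < t i := by
  have := h i
  unfold InGap at this
  omega

theorem SameBlock.apply_le (h : SameBlock t i j) (hij : i < j) : t i ≤ j := by
  have := h i
  unfold InGap at this
  omega

theorem SameBlock.lt_apply_or_apply_le (h : SameBlock t i j) : j < t j ∨ t j ≤ i := by
  have := h j
  unfold InGap at this
  omega

theorem SameBlock.apply_le_of_between (h : SameBlock t i j) (hil : i < l) (hlj : l < j)
    (hlt : l ≤ t l) : t l ≤ j := by
  have := h l
  unfold InGap at this
  omega

/-- Since `i` and `j` share a block, `t` never jumps over `j` when iterated upwards from `i`. -/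
theorem SameBlock.mono (h : SameBlock t i j) (ht : Noncrossing t) (htu : Refines t u) :
    SameBlock u i j := by
  wlog hij : i ≤ j generalizing i j
  · exact (this h.symm (Nat.le_of_not_le hij)).symm
  induction hd : j - i using Nat.strong_induction_on generalizing i with
  | _ d ih =>
    rcases hij.eq_or_lt with rfl | hlt
    · exact .refl u i
    · have hi := h.lt_apply hlt
      exact (htu i).trans (ih _ (by omega) ((ht i).symm.trans h) (h.apply_le hlt) rfl)

theorem SameBlock.of_crossing {m : ℕ} (h : SameBlock u i m) (h' : SameBlock u j l)
    (hj : InGap i m j) (hl : ¬ InGap i m l) : SameBlock u i j := by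
  intro k
  have hk := h k
  have hk' := h' k
  unfold InGap at *
  grind

theorem one_refines (t : Perm ℕ) : Refines 1 t := fun j => .refl t j

theorem Refines.trans (hst : Refines s t) (htu : Refines t u) (ht : Noncrossing t) :
    Refines s u := fun j => (hst j).mono ht htu

theorem Refines.antisymm (h : Refines s t) (h' : Refines t s) : s = t := by
  ext i
  have hi := h i i
  have hi' := h' i i
  unfold InGap at hi hi'
  omega

theorem Refines.inv (h : Refines s t) : Refines s⁻¹ t := fun j => by
  simpa only [Perm.coe_inv, apply_symm_apply] using (h (s⁻¹ j)).symm

theorem Refines.mul (h : Refines r t) (h' : Refines s t) : Refines (r * s) t := fun j =>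
  (h' j).trans (h (s j))

theorem Refines.mul_inv_refines_mul_inv (hv : Noncrossing v) (hu : Noncrossing u)
    (hwv : Refines w v) (hvu : Refines v u) : Refines (u * v⁻¹) (u * w⁻¹) := by
  intro j i
  obtain ⟨k, rfl⟩ := w.surjective i
  obtain ⟨m, rfl⟩ := v.surjective j
  -- It remains to see that the arc from `w k` to `u k` does not separate `v m` from `u m`.
  simp only [Perm.mul_apply, Perm.coe_inv, symm_apply_apply]
  rcases eq_or_ne m k with rfl | hmk
  · have hw := hwv m m
    have hv := hvu m m
    unfold InGap at *
    omega
  have h_v_arc := hwv k m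
  have h_u_arc := hvu m k
  have h_u_arc' := hu m k
  have h_uw_arc := hwv.trans hvu hv k m
  unfold InGap at *
  grind

theorem Refines.inv_mul_refines_inv_mul (hv : Noncrossing v) (hu : Noncrossing u)
    (hwv : Refines w v) (hvu : Refines v u) : Refines (v⁻¹ * u) (w⁻¹ * u) := by
  intro j i
  have hwu := hwv.trans hvu hv
  obtain ⟨k, hk⟩ := w.surjective (u i)
  obtain ⟨m, hm⟩ := v.surjective (u j)
  -- It remains to see that the arc from `i` to `k` does not separate `j` from `m`.
  simp only [Perm.mul_apply]
  rw [← hk, ← hm, Perm.coe_inv, Perm.coe_inv, symm_apply_apply, symm_apply_apply]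
  have h_u_i := hk ▸ hwu k i
  have h_u_j := hm ▸ hvu m j
  have h_v_m := hm ▸ hk ▸ hwv k m
  rcases eq_or_ne i j with rfl | hij
  · unfold InGap at *
    omega
  have huij : u i ≠ u j := u.injective.ne hij
  have h_u_ji := hu j i
  have h_u_kj := hk ▸ hwu k j
  have h_u_mi := hm ▸ hvu m i
  unfold InGap at *
  grind

theorem Noncrossing.mul_inv (hu : Noncrossing u) (hv : Noncrossing v) (h : Refines v u) :
    Noncrossing (u * v⁻¹) :=
  Refines.mul_inv_refines_mul_inv hv hu hv h

theorem Noncrossing.inv_mul (hu : Noncrossing u) (hv : Noncrossing v) (h : Refines v u) :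
    Noncrossing (v⁻¹ * u) :=
  Refines.inv_mul_refines_inv_mul hv hu hv h

theorem Refines.conj (hst : Refines s t) (hs : Noncrossing s) (ht : Noncrossing t)
    (hu : Noncrossing u) (htu : Refines t u) : Refines (u * s * u⁻¹) (u * t * u⁻¹) := by
  have hsu := hst.trans htu ht
  have h := Refines.mul_inv_refines_mul_inv (hu.mul_inv hs hsu) hu
    (Refines.mul_inv_refines_mul_inv ht hu hst htu) (hu.mul hsu.inv)
  simpa only [mul_inv_rev, inv_inv, mul_assoc] using h

theorem Refines.inv_conj (hst : Refines s t) (hs : Noncrossing s) (ht : Noncrossing t)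
    (hu : Noncrossing u) (htu : Refines t u) : Refines (u⁻¹ * s * u) (u⁻¹ * t * u) := by
  have hsu := hst.trans htu ht
  have h := Refines.inv_mul_refines_inv_mul (hu.inv_mul hs hsu) hu
    (Refines.inv_mul_refines_inv_mul ht hu hst htu) (hsu.inv.mul hu)
  simpa only [mul_inv_rev, inv_inv, mul_assoc] using h

theorem Refines.mul_inv_right (hst : Refines s t) (hs : Noncrossing s) (ht : Noncrossing t)
    (hu : Noncrossing u) (htu : Refines t u) : Refines (t * s⁻¹) (u * s⁻¹) := by
  have hsu := hst.trans htu ht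
  have h := (Refines.mul_inv_refines_mul_inv ht hu hst htu).inv.mul (hu.mul_inv hs hsu)
  simpa only [mul_inv_rev, inv_inv, mul_assoc, inv_mul_cancel_left] using h

theorem Refines.mul_right (hvw : Refines v w) (hs : Noncrossing s) (hu : Noncrossing u)
    (hv : Noncrossing v) (hw : Noncrossing w) (hsu : Refines s u) (hwu : Refines w (u * s⁻¹)) :
    Refines (v * s) (w * s) := by
  have hq := hu.mul_inv hs hsu
  have hvu := hvw.trans hwu hw
  have h := Refines.inv_mul_refines_inv_mul (hq.mul_inv hv hvu) hu
    (Refines.mul_inv_refines_mul_inv hw hq hvw hwu)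
    ((hq.mul hvu.inv).trans (hu.mul hsu.inv) hq)
  simpa only [mul_inv_rev, inv_inv, mul_assoc, inv_mul_cancel, mul_one] using h

end NoncrossingPermutations

section Support

variable {i j m n : ℕ} {s t u : Perm ℕ}

/-- `t` moves only points of `{1, …, n}`. -/
def SupportedUpTo (n : ℕ) (t : Perm ℕ) : Prop := ∀ i, ¬ (1 ≤ i ∧ i ≤ n) → t i = i

namespace SupportedUpTo

theorem one (n : ℕ) : SupportedUpTo n 1 := fun _ _ => rfl

theorem mono (ht : SupportedUpTo m t) (h : m ≤ n) : SupportedUpTo n t :=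
  fun i hi => ht i (by omega)

theorem mul (hs : SupportedUpTo n s) (ht : SupportedUpTo n t) : SupportedUpTo n (s * t) :=
  fun i hi => by rw [Perm.mul_apply, ht i hi, hs i hi]

theorem inv (hs : SupportedUpTo n s) : SupportedUpTo n s⁻¹ :=
  fun i hi => by rw [Perm.inv_eq_iff_eq, hs i hi]

theorem apply_mem (hs : SupportedUpTo n s) (hi : 1 ≤ i ∧ i ≤ n) : 1 ≤ s i ∧ s i ≤ n := by
  by_contra h
  rw [s.injective (hs _ h)] at h
  exact h hi

theorem eq_of_sameBlock (hu : SupportedUpTo n u) (hi : ¬ (1 ≤ i ∧ i ≤ n))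
    (h : SameBlock u i j) : j = i := by
  have hii := h i
  rw [hu i hi] at hii
  unfold InGap at hii
  omega

theorem of_refines (hu : SupportedUpTo n u) (h : Refines t u) : SupportedUpTo n t :=
  fun i hi => hu.eq_of_sameBlock hi (h i)

end SupportedUpTo

/-- The cycle `(1 2 … n)`, which encodes the coarsest partition of `{1, …, n}`. -/
def cyc (n : ℕ) : Perm ℕ where
  toFun i := if 1 ≤ i ∧ i < n then i + 1 else if 1 ≤ i ∧ i = n then 1 else i
  invFun i := if 2 ≤ i ∧ i ≤ n then i - 1 else if i = 1 ∧ 1 ≤ n then n else i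
  left_inv i := by grind
  right_inv i := by grind

theorem cyc_apply (n i : ℕ) :
    cyc n i = if 1 ≤ i ∧ i < n then i + 1 else if 1 ≤ i ∧ i = n then 1 else i := rfl

theorem supportedUpTo_cyc (n : ℕ) : SupportedUpTo n (cyc n) := by
  intro i hi
  rw [cyc_apply]
  grind

theorem SupportedUpTo.refines_cyc (ht : SupportedUpTo n t) : Refines t (cyc n) := by
  intro j k
  rw [cyc_apply]
  by_cases hj : 1 ≤ j ∧ j ≤ n
  · have := ht.apply_mem hj
    unfold InGap
    grind
  · rw [ht j hj]

end Support

section Meet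

variable {U : Set (Perm ℕ)} {n : ℕ}

/-- `i` and `j` lie in the same block of every member of `U`: the block relation of the meet
of `U`. -/
def SameBlockInAll (U : Set (Perm ℕ)) (i j : ℕ) : Prop := ∀ u ∈ U, SameBlock u i j

theorem SameBlockInAll.exists_next (U : Set (Perm ℕ)) (i : ℕ) :
    ∃ x, SameBlockInAll U i x ∧ ∀ j, SameBlockInAll U i j → ¬ InGap i x j := by
  classical
  by_cases h : ∃ j, i < j ∧ SameBlockInAll U i j
  · refine ⟨Nat.find h, (Nat.find_spec h).2, fun j hj hgap => ?_⟩
    have hlt := (Nat.find_spec h).1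
    have hbetween : i < j ∧ j < Nat.find h := by unfold InGap at hgap; omega
    exact Nat.find_min h hbetween.2 ⟨hbetween.1, hj⟩
  · have hself : SameBlockInAll U i i := fun u _ => .refl u i
    have hex : ∃ j, SameBlockInAll U i j := ⟨i, hself⟩
    refine ⟨Nat.find hex, Nat.find_spec hex, fun j hj hgap => ?_⟩
    have hle : Nat.find hex ≤ i := Nat.find_min' hex hself
    have houtside : i < j ∨ j < Nat.find hex := by unfold InGap at hgap; omega
    rcases houtside with hij | hlt
    · exact h ⟨j, hij, hj⟩
    · exact Nat.find_min hex hlt hj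

theorem surjective_of_injective_of_finite_ne {α : Type*} {f : α → α} (hf : Function.Injective f)
    (hfin : {i | f i ≠ i}.Finite) : Function.Surjective f := by
  have hmaps : Set.MapsTo f {i | f i ≠ i} {i | f i ≠ i} := fun i hi => hf.ne hi
  have hsurj := ((hfin.injOn_iff_bijOn_of_mapsTo hmaps).1 hf.injOn).surjOn
  intro j
  by_cases hj : f j = j
  · exact ⟨j, hj⟩
  · obtain ⟨i, -, hi⟩ := hsurj hj
    exact ⟨i, hi⟩

/-- The meet sends `i` to the next member of its class for `SameBlockInAll U`. -/
theorem exists_greatest_refines {u₀ : Perm ℕ} (hu₀ : u₀ ∈ U) (hn : SupportedUpTo n u₀) :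
    ∃ m : Perm ℕ, (∀ u ∈ U, Refines m u) ∧ ∀ s, (∀ u ∈ U, Refines s u) → Refines s m := by
  choose next hnext hgap using SameBlockInAll.exists_next U
  have hinj : Function.Injective next := by
    intro i j hij
    have hclass : SameBlockInAll U i j :=
      fun u hu => (hnext i u hu).trans (hij ▸ (hnext j u hu).symm)
    have hi := hgap i j hclass
    have hj := hgap j i fun u hu => (hclass u hu).symm
    rw [← hij] at hj
    unfold InGap at hi hj
    omega
  have hfin : {i | next i ≠ i}.Finite := (Set.finite_Icc 1 n).subset fun i hi => by
    by_contra hout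
    exact hi (hn.eq_of_sameBlock hout (hnext i u₀ hu₀))
  let m := Equiv.ofBijective next ⟨hinj, surjective_of_injective_of_finite_ne hinj hfin⟩
  have hgap_class : ∀ i j l, SameBlockInAll U j l → InGap i (m i) j → InGap i (m i) l := by
    intro i j l hjl hj
    by_contra hl
    exact hgap i j (fun u hu => (hnext i u hu).of_crossing (hjl u hu) hj hl) hj
  exact ⟨m, fun u hu j => hnext j u hu, fun s hs j k =>
    ⟨hgap_class k j (s j) fun u hu => hs u hu j,
      hgap_class k (s j) j fun u hu => (hs u hu j).symm⟩⟩

end Meet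

/-- Noncrossing permutations of bounded support. They are the simple elements of all the monoids
`BKLₙ` at once: those of `BKLₙ` are supported in `{1, …, n}`. -/
@[ext]
structure NC : Type where
  perm : Perm ℕ
  noncrossing : Noncrossing perm
  exists_supportedUpTo : ∃ n, SupportedUpTo n perm

namespace NC

variable {n : ℕ} {s t : NC}

instance : One NC := ⟨1, one_refines 1, 0, .one 0⟩

@[simp]
theorem perm_one : (1 : NC).perm = 1 := rfl

instance : PartialOrder NC where
  le s t := Refines s.perm t.perm
  le_refl s := s.noncrossing
  le_trans _ t _ h h' := h.trans h' t.noncrossing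
  le_antisymm _ _ h h' := NC.ext (h.antisymm h')

theorem le_def : s ≤ t ↔ Refines s.perm t.perm := Iff.rfl

instance : OrderBot NC where
  bot := 1
  bot_le t := one_refines t.perm

theorem one_le (t : NC) : 1 ≤ t := bot_le

theorem exists_isLUB (s t : NC) : ∃ m : NC, IsLUB {s, t} m := by
  obtain ⟨n₁, h₁⟩ := s.exists_supportedUpTo
  obtain ⟨n₂, h₂⟩ := t.exists_supportedUpTo
  set n := max n₁ n₂
  let U := {u : Perm ℕ | Noncrossing u ∧ Refines s.perm u ∧ Refines t.perm u}
  have hcyc := supportedUpTo_cyc n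
  have hU : cyc n ∈ U := ⟨hcyc.refines_cyc, (h₁.mono (le_max_left ..)).refines_cyc,
    (h₂.mono (le_max_right ..)).refines_cyc⟩
  obtain ⟨m, hm, hgreatest⟩ := exists_greatest_refines hU hcyc
  refine ⟨⟨m, hgreatest m hm, n, hcyc.of_refines (hm _ hU)⟩, ?_, fun u hu => ?_⟩
  · rintro x (rfl | rfl)
    · exact hgreatest _ fun u hu => hu.2.1
    · exact hgreatest _ fun u hu => hu.2.2
  · exact hm u.perm ⟨u.noncrossing, hu (by simp), hu (by simp)⟩

noncomputable instance : SemilatticeSup NC where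
  sup s t := (exists_isLUB s t).choose
  le_sup_left s t := (exists_isLUB s t).choose_spec.1 (by simp)
  le_sup_right s t := (exists_isLUB s t).choose_spec.1 (by simp)
  sup_le s t u hs ht := (exists_isLUB s t).choose_spec.2 (by simp [upperBounds, hs, ht])

/-- The cycle `(1 2 … n)` as a noncrossing permutation. It is the Garside element of `BKLₙ`. -/
def cycle (n : ℕ) : NC where
  perm := cyc n
  noncrossing := (supportedUpTo_cyc n).refines_cyc
  exists_supportedUpTo := ⟨n, supportedUpTo_cyc n⟩

@[simp]
theorem perm_cycle (n : ℕ) : (cycle n).perm = cyc n := rfl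

theorem le_cycle (hs : SupportedUpTo n s.perm) : s ≤ cycle n := hs.refines_cyc

theorem supportedUpTo_sup (hs : SupportedUpTo n s.perm) (ht : SupportedUpTo n t.perm) :
    SupportedUpTo n (s ⊔ t).perm :=
  (supportedUpTo_cyc n).of_refines (sup_le (le_cycle hs) (le_cycle ht))

end NC

/-! ### Complemented monoids of words -/

/-- A set with a complement operation satisfying the cube law (an `L`-algebra); `res s t` plays the
role of the `x` such that `x * s` is the least common left-multiple of `s` and `t`. -/
class Complemented (S : Type*) extends One S where
  res : S → S → S
  res_self : ∀ s, res s s = 1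
  res_one : ∀ s, res s 1 = 1
  one_res : ∀ s, res 1 s = s
  cube : ∀ s t u, res (res s t) (res s u) = res (res t s) (res t u)

namespace Complemented

variable {S : Type*} [Complemented S] {s t : S} {u u' v v' w : List S}

section WordComplement

/-- The complement of a word after a letter. Words are read from right to left: the list
`[s₁, …, sₖ]` stands for the product `sₖ ⋯ s₁`. -/
def letterResWord : S → List S → List S
  | _, [] => []
  | s, t :: w => res s t :: letterResWord (res t s) w

/-- The complement of a letter after a word. -/
def wordResLetter : List S → S → S
  | [], s => s
  | t :: w, s => wordResLetter w (res t s)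

/-- The complement of the second word after the first one. -/
def wordRes : List S → List S → List S
  | [], w => w
  | s :: u, w => wordRes u (letterResWord s w)

theorem wordRes_cons (s : S) (u w : List S) :
    wordRes (s :: u) w = wordRes u (letterResWord s w) := rfl

theorem wordRes_nil (u : List S) : wordRes u [] = [] := by
  induction u with
  | nil => rfl
  | cons _ _ ih => exact ih

theorem one_letterResWord (w : List S) : letterResWord 1 w = w := by
  induction w with
  | nil => rfl
  | cons t w ih => rw [letterResWord, res_one, one_res, ih]

theorem wordResLetter_one (w : List S) : wordResLetter w 1 = 1 := by
  induction w with
  | nil => rfl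
  | cons t w ih => rw [wordResLetter, res_one, ih]

theorem wordRes_cons_right (v : List S) (s : S) (u : List S) :
    wordRes v (s :: u) = wordResLetter v s :: wordRes (letterResWord s v) u := by
  induction v generalizing s u with
  | nil => rfl
  | cons t v ih => rw [wordRes, letterResWord, ih]; rfl

theorem letterResWord_cube (s t : S) (w : List S) :
    letterResWord (res s t) (letterResWord s w) =
      letterResWord (res t s) (letterResWord t w) := by
  induction w generalizing s t with
  | nil => rfl
  | cons x w ih =>
    simp only [letterResWord]
    rw [cube s t x, cube s x t, ih, cube x t s]

theorem wordRes_letterResWord_cube (s : S) (v w : List S) :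
    wordRes (letterResWord s v) (letterResWord s w) =
      letterResWord (wordResLetter v s) (wordRes v w) := by
  induction v generalizing s w with
  | nil => rfl
  | cons t v ih => rw [letterResWord, wordRes, letterResWord_cube, ih]; rfl

theorem wordRes_cube (u v w : List S) :
    wordRes (wordRes u v) (wordRes u w) = wordRes (wordRes v u) (wordRes v w) := by
  induction u generalizing v w with
  | nil => rw [wordRes_nil]; rfl
  | cons s u ih =>
    rw [wordRes_cons, wordRes_cons, ih, wordRes_letterResWord_cube, wordRes_cons_right,
      wordRes_cons]

theorem append_wordRes (u v w : List S) : wordRes (u ++ v) w = wordRes v (wordRes u w) := by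
  induction u generalizing w with
  | nil => rfl
  | cons s u ih => rw [List.cons_append, wordRes_cons, ih, wordRes_cons]

theorem wordRes_append (w u v : List S) :
    wordRes w (u ++ v) = wordRes w u ++ wordRes (wordRes u w) v := by
  induction u generalizing w with
  | nil => rw [wordRes_nil]; rfl
  | cons s u ih => rw [List.cons_append, wordRes_cons_right, wordRes_cons_right, ih]; rfl

end WordComplement

section TrivialWords

/-- All letters of `w` are `1`; these are the words that represent `1`. -/
def AllOnes (w : List S) : Prop := ∀ s ∈ w, s = 1

theorem allOnes_nil : AllOnes ([] : List S) := List.forall_mem_nil _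

theorem allOnes_cons : AllOnes (s :: w) ↔ s = 1 ∧ AllOnes w := List.forall_mem_cons

theorem allOnes_append : AllOnes (u ++ v) ↔ AllOnes u ∧ AllOnes v := List.forall_mem_append

theorem AllOnes.letterResWord (hw : AllOnes w) (s : S) : AllOnes (letterResWord s w) := by
  induction w generalizing s with
  | nil => exact hw
  | cons t w ih =>
    obtain ⟨rfl, hw'⟩ := allOnes_cons.1 hw
    exact allOnes_cons.2 ⟨res_one s, ih hw' _⟩

theorem AllOnes.wordRes_right (hw : AllOnes w) (u : List S) : AllOnes (wordRes u w) := by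
  induction u generalizing w with
  | nil => exact hw
  | cons s _ ih => exact ih (hw.letterResWord s)

theorem AllOnes.wordRes_eq (hu : AllOnes u) (w : List S) : wordRes u w = w := by
  induction u with
  | nil => rfl
  | cons s u ih =>
    obtain ⟨rfl, hu'⟩ := allOnes_cons.1 hu
    rw [wordRes_cons, one_letterResWord, ih hu']

theorem allOnes_wordRes_self (u : List S) : AllOnes (wordRes u u) := by
  induction u with
  | nil => exact allOnes_nil
  | cons s u ih =>
    rw [wordRes_cons, letterResWord, res_self, one_letterResWord, wordRes_cons_right,
      one_letterResWord, wordResLetter_one]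
    exact allOnes_cons.2 ⟨rfl, ih⟩

end TrivialWords

section WordDvd

/-- The element represented by `u` right-divides the one represented by `w`. -/
def WordDvd (u w : List S) : Prop := AllOnes (wordRes w u)

theorem WordDvd.refl (u : List S) : WordDvd u u := allOnes_wordRes_self u

theorem WordDvd.trans (huv : WordDvd u v) (hvw : WordDvd v w) : WordDvd u w := by
  have hcube := wordRes_cube w v u
  rw [AllOnes.wordRes_eq hvw] at hcube
  rw [WordDvd, hcube]
  exact huv.wordRes_right _

theorem AllOnes.wordDvd (hu : AllOnes u) (v : List S) : WordDvd u v := hu.wordRes_right v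

theorem wordDvd_append (u v : List S) : WordDvd u (u ++ v) := by
  rw [WordDvd, append_wordRes]
  exact (allOnes_wordRes_self u).wordRes_right v

theorem wordDvd_append_wordRes (u v : List S) : WordDvd v (u ++ wordRes u v) := by
  rw [WordDvd, append_wordRes]
  exact allOnes_wordRes_self _

theorem append_wordRes_wordDvd (hu : WordDvd u w) (hv : WordDvd v w) :
    WordDvd (u ++ wordRes u v) w := by
  rw [WordDvd, wordRes_append, allOnes_append, wordRes_cube, AllOnes.wordRes_eq hu]
  exact ⟨hu, hv⟩

theorem WordDvd.append (hu : WordDvd u u') (hu' : WordDvd u' u) (hv : WordDvd v v') :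
    WordDvd (u ++ v) (u' ++ v') := by
  rw [WordDvd, append_wordRes, wordRes_append, wordRes_append, allOnes_append,
    AllOnes.wordRes_eq hu', AllOnes.wordRes_eq hu]
  exact ⟨hu.wordRes_right _, hv⟩

theorem WordDvd.of_append_left (h : WordDvd (u ++ v) (u ++ v')) : WordDvd v v' := by
  have hself := allOnes_wordRes_self u
  rw [WordDvd, append_wordRes, wordRes_append, wordRes_append, allOnes_append,
    hself.wordRes_eq, hself.wordRes_eq] at h
  exact h.2

end WordDvd

section WordEquiv

/-- `u` and `v` represent the same element. -/
def WordEquiv (u v : List S) : Prop := WordDvd u v ∧ WordDvd v u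

theorem WordEquiv.refl (u : List S) : WordEquiv u u := ⟨.refl u, .refl u⟩

theorem WordEquiv.symm (h : WordEquiv u v) : WordEquiv v u := ⟨h.2, h.1⟩

theorem WordEquiv.trans (h : WordEquiv u v) (h' : WordEquiv v w) : WordEquiv u w :=
  ⟨h.1.trans h'.1, h'.2.trans h.2⟩

theorem WordEquiv.append (h : WordEquiv u u') (h' : WordEquiv v v') :
    WordEquiv (u ++ v) (u' ++ v') := ⟨h.1.append h.2 h'.1, h.2.append h.1 h'.2⟩

theorem WordEquiv.append_left_cancel (h : WordEquiv (u ++ v) (u ++ v')) : WordEquiv v v' :=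
  ⟨h.1.of_append_left, h.2.of_append_left⟩

theorem append_wordRes_equiv (u v : List S) :
    WordEquiv (u ++ wordRes u v) (v ++ wordRes v u) :=
  ⟨append_wordRes_wordDvd (wordDvd_append_wordRes v u) (wordDvd_append _ _),
    append_wordRes_wordDvd (wordDvd_append_wordRes u v) (wordDvd_append _ _)⟩

theorem AllOnes.equiv (hu : AllOnes u) (hv : AllOnes v) : WordEquiv u v :=
  ⟨hu.wordDvd v, hv.wordDvd u⟩

theorem WordDvd.equiv_append (h : WordDvd u w) : WordEquiv w (u ++ wordRes u w) := by
  have hw : WordEquiv (w ++ wordRes w u) (w ++ []) :=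
    (WordEquiv.refl w).append (AllOnes.equiv h allOnes_nil)
  rw [List.append_nil] at hw
  exact hw.symm.trans (append_wordRes_equiv w u)

end WordEquiv

variable (S) in
/-- The monoid presented by the relations `res s t * s = res t s * t`, realised as words up to
`WordEquiv`. -/
def WordMonoid : Type _ :=
  Quotient (⟨WordEquiv, .refl, .symm, .trans⟩ : Setoid (List S))

namespace WordMonoid

/-- The element represented by a word. -/
def mk (u : List S) : WordMonoid S := Quotient.mk _ u

theorem mk_eq_mk : mk u = mk v ↔ WordEquiv u v := ⟨Quotient.exact, fun h => Quotient.sound h⟩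

@[elab_as_elim]
theorem ind {p : WordMonoid S → Prop} (mk : ∀ u, p (mk u)) (x : WordMonoid S) : p x :=
  Quotient.ind mk x

/-- The class of `u` times the class of `v` is the class of `v ++ u`, since words are read from
right to left. -/
instance : Monoid (WordMonoid S) where
  mul := Quotient.map₂ (fun u v => v ++ u) fun _ _ h _ _ h' => h'.append h
  one := mk []
  mul_assoc x y z := by
    induction x using ind with | mk u
    induction y using ind with | mk v
    induction z using ind with | mk w
    exact congrArg mk (List.append_assoc w v u).symm
  one_mul x := by
    induction x using ind with | mk u
    exact congrArg mk (List.append_nil u)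
  mul_one x := by
    induction x using ind with | mk u
    rfl

theorem mk_nil : mk ([] : List S) = 1 := rfl

instance : IsRightCancelMul (WordMonoid S) where
  mul_right_cancel z x y h := by
    induction x using ind with | mk u
    induction y using ind with | mk v
    induction z using ind with | mk w
    exact mk_eq_mk.2 (mk_eq_mk.1 h).append_left_cancel

theorem exists_common_left_mul (x y : WordMonoid S) : ∃ x' y', x' * x = y' * y := by
  induction x using ind with | mk u
  induction y using ind with | mk v
  exact ⟨mk (wordRes u v), mk (wordRes v u), mk_eq_mk.2 (append_wordRes_equiv u v)⟩

/-- The element represented by a single letter. -/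
def of (s : S) : WordMonoid S := mk [s]

theorem mk_cons (s : S) (u : List S) : mk (s :: u) = mk u * of s := rfl

theorem of_one : of (1 : S) = 1 :=
  mk_eq_mk.2 (AllOnes.equiv (allOnes_cons.2 ⟨rfl, allOnes_nil⟩) allOnes_nil)

theorem of_res_mul_of (s t : S) : of (res s t) * of s = of (res t s) * of t :=
  mk_eq_mk.2 (append_wordRes_equiv [s] [t])

end WordMonoid

end Complemented

open Complemented

namespace NC

variable {n : ℕ} {s t u w : NC}

/-- The quotient `t s⁻¹` of noncrossing permutations with `s ≤ t`. -/
def div (t s : NC) (h : s ≤ t) : NC where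
  perm := t.perm * s.perm⁻¹
  noncrossing := t.noncrossing.mul_inv s.noncrossing h
  exists_supportedUpTo := t.exists_supportedUpTo.imp fun _ ht => ht.mul (ht.of_refines h).inv

theorem perm_div (h : s ≤ t) : (div t s h).perm = t.perm * s.perm⁻¹ := rfl

theorem perm_div_mul (h : s ≤ t) : (div t s h).perm * s.perm = t.perm :=
  inv_mul_cancel_right _ _

theorem supportedUpTo_div (h : s ≤ t) (ht : SupportedUpTo n t.perm) :
    SupportedUpTo n (div t s h).perm :=
  ht.mul (ht.of_refines h).inv

theorem div_le_div (hst : s ≤ t) (htu : t ≤ u) : div t s hst ≤ div u s (hst.trans htu) :=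
  Refines.mul_inv_right hst s.noncrossing t.noncrossing u.noncrossing htu

theorem div_le_div_iff (ht : s ≤ t) (hu : s ≤ u) : div t s ht ≤ div u s hu ↔ t ≤ u := by
  refine ⟨fun h => ?_, div_le_div ht⟩
  have hmul := Refines.mul_right h s.noncrossing (t ⊔ u).noncrossing (div t s ht).noncrossing
    (div u s hu).noncrossing (ht.trans le_sup_left) (div_le_div hu le_sup_right)
  rwa [perm_div_mul, perm_div_mul] at hmul

theorem exists_div_eq (hst : s ≤ t) (hw : w ≤ div t s hst) :
    ∃ (y : NC) (hy : s ≤ y), div y s hy = w := by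
  have hmul : ∀ {x y : NC}, x ≤ y → y ≤ div t s hst →
      Refines (x.perm * s.perm) (y.perm * s.perm) := fun {x y} hxy hy =>
    Refines.mul_right hxy s.noncrossing t.noncrossing x.noncrossing y.noncrossing hst hy
  have hle : Refines (w.perm * s.perm) t.perm := by
    simpa only [perm_div_mul] using hmul hw le_rfl
  let y : NC := ⟨w.perm * s.perm, hmul le_rfl hw,
    t.exists_supportedUpTo.imp fun _ ht => ht.of_refines hle⟩
  have hsy : s ≤ y := by
    rw [le_def]
    simpa only [perm_one, one_mul] using hmul (one_le w) hw
  exact ⟨y, hsy, NC.ext (mul_inv_cancel_right _ _)⟩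

theorem div_sup_div (ht : s ≤ t) (hu : s ≤ u) :
    div t s ht ⊔ div u s hu = div (t ⊔ u) s (ht.trans le_sup_left) := by
  have hle : div t s ht ⊔ div u s hu ≤ div (t ⊔ u) s (ht.trans le_sup_left) :=
    sup_le (div_le_div ht le_sup_left) (div_le_div hu le_sup_right)
  refine le_antisymm hle ?_
  obtain ⟨y, hsy, hy⟩ := exists_div_eq _ hle
  rw [← hy, div_le_div_iff]
  exact sup_le ((div_le_div_iff ht hsy).1 (hy ▸ le_sup_left))
    ((div_le_div_iff hu hsy).1 (hy ▸ le_sup_right))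

noncomputable instance : Complemented NC where
  res s t := div (s ⊔ t) s le_sup_left
  res_self s := by ext1; simp [perm_div]
  res_one s := by ext1; simp [perm_div, sup_eq_left.2 s.one_le]
  one_res s := by ext1; simp [perm_div, sup_eq_right.2 s.one_le]
  cube s t u := by
    have hsup : (s ⊔ t) ⊔ (s ⊔ u) = (t ⊔ s) ⊔ (t ⊔ u) := by
      rw [← sup_sup_distrib_left, ← sup_sup_distrib_left, sup_left_comm]
    ext1
    simp only [div_sup_div, hsup, perm_div, sup_comm t s]
    group

theorem perm_res (s t : NC) : (res s t).perm = (s ⊔ t).perm * s.perm⁻¹ := rfl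

theorem res_eq_one : res s t = 1 ↔ t ≤ s := by
  rw [NC.ext_iff, perm_res, perm_one, mul_inv_eq_one, ← NC.ext_iff, sup_eq_left]

theorem supportedUpTo_res (hs : SupportedUpTo n s.perm) (ht : SupportedUpTo n t.perm) :
    SupportedUpTo n (res s t).perm :=
  (supportedUpTo_sup hs ht).mul hs.inv

end NC

namespace Complemented.WordMonoid

variable {q s t : NC}

theorem of_mul_of (h : s ≤ t) (hq : q.perm * s.perm = t.perm) : of q * of s = of t := by
  have hres : q = res s t := by
    ext1
    rw [NC.perm_res, sup_eq_right.2 h, ← hq, mul_inv_cancel_right]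
  rw [hres, of_res_mul_of, NC.res_eq_one.2 h, of_one, one_mul]

theorem of_div_mul_of (h : s ≤ t) : of (NC.div t s h) * of s = of t :=
  of_mul_of h (NC.perm_div_mul h)

end Complemented.WordMonoid

/-! ### Words in the noncrossing permutations -/

open WordMonoid

/-- The word `u` has all its letters supported in `{1, …, n}`. -/
def SupportedWord (n : ℕ) (u : List NC) : Prop := ∀ s ∈ u, SupportedUpTo n s.perm

namespace SupportedWord

variable {n : ℕ} {s : NC} {u v : List NC}

theorem nil (n : ℕ) : SupportedWord n [] := List.forall_mem_nil _

theorem cons_iff : SupportedWord n (s :: u) ↔ SupportedUpTo n s.perm ∧ SupportedWord n u :=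
  List.forall_mem_cons

theorem append_iff : SupportedWord n (u ++ v) ↔ SupportedWord n u ∧ SupportedWord n v :=
  List.forall_mem_append

theorem singleton (hs : SupportedUpTo n s.perm) : SupportedWord n [s] :=
  List.forall_mem_singleton.2 hs

theorem mono {m : ℕ} (hu : SupportedWord m u) (h : m ≤ n) : SupportedWord n u :=
  fun s hs => (hu s hs).mono h

theorem letterResWord (hs : SupportedUpTo n s.perm) (hu : SupportedWord n u) :
    SupportedWord n (letterResWord s u) := by
  induction u generalizing s with
  | nil => exact hu
  | cons t u ih =>
    rw [cons_iff] at hu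
    exact cons_iff.2 ⟨NC.supportedUpTo_res hs hu.1, ih (NC.supportedUpTo_res hu.1 hs) hu.2⟩

theorem wordRes (hu : SupportedWord n u) (hv : SupportedWord n v) :
    SupportedWord n (wordRes u v) := by
  induction u generalizing v with
  | nil => exact hv
  | cons t u ih =>
    rw [cons_iff] at hu
    exact ih hu.2 (letterResWord hu.1 hv)

end SupportedWord

theorem exists_supportedWord (u : List NC) : ∃ n, SupportedWord n u := by
  induction u with
  | nil => exact ⟨0, .nil 0⟩
  | cons t u ih =>
    obtain ⟨n, hu⟩ := ih
    obtain ⟨m, ht⟩ := t.exists_supportedUpTo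
    exact ⟨max m n, SupportedWord.cons_iff.2
      ⟨ht.mono (le_max_left m n), hu.mono (le_max_right m n)⟩⟩

namespace NC

variable {n : ℕ} {s t : NC}

open Classical in
/-- The conjugate of `s` by the cycle `(1 2 … n)`. This is a noncrossing permutation when `s` is
supported in `{1, …, n}`; otherwise the value is `s`. -/
noncomputable def rotate (n : ℕ) (s : NC) : NC :=
  if hs : SupportedUpTo n s.perm then
    { perm := cyc n * s.perm * (cyc n)⁻¹
      noncrossing :=
        s.noncrossing.conj s.noncrossing s.noncrossing (cycle n).noncrossing hs.refines_cyc
      exists_supportedUpTo :=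
        ⟨n, ((supportedUpTo_cyc n).mul hs).mul (supportedUpTo_cyc n).inv⟩ }
  else s

theorem perm_rotate (hs : SupportedUpTo n s.perm) :
    (rotate n s).perm = cyc n * s.perm * (cyc n)⁻¹ := by
  rw [rotate, dif_pos hs]

theorem supportedUpTo_rotate (hs : SupportedUpTo n s.perm) :
    SupportedUpTo n (rotate n s).perm := by
  rw [perm_rotate hs]
  exact ((supportedUpTo_cyc n).mul hs).mul (supportedUpTo_cyc n).inv

theorem rotate_le_rotate (hs : SupportedUpTo n s.perm) (ht : SupportedUpTo n t.perm)
    (h : s ≤ t) : rotate n s ≤ rotate n t := by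
  rw [le_def, perm_rotate hs, perm_rotate ht]
  exact Refines.conj h s.noncrossing t.noncrossing (cycle n).noncrossing ht.refines_cyc

theorem le_of_rotate_le_rotate (hs : SupportedUpTo n s.perm) (ht : SupportedUpTo n t.perm)
    (h : rotate n s ≤ rotate n t) : s ≤ t := by
  have hinv := Refines.inv_conj h (rotate n s).noncrossing (rotate n t).noncrossing
    (cycle n).noncrossing (supportedUpTo_rotate ht).refines_cyc
  simpa [perm_rotate hs, perm_rotate ht, mul_assoc, ← le_def] using hinv

theorem rotate_injective (hs : SupportedUpTo n s.perm) (ht : SupportedUpTo n t.perm)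
    (h : rotate n s = rotate n t) : s = t :=
  le_antisymm (le_of_rotate_le_rotate hs ht h.le) (le_of_rotate_le_rotate ht hs h.ge)

theorem exists_rotate_eq (ht : SupportedUpTo n t.perm) :
    ∃ s : NC, SupportedUpTo n s.perm ∧ rotate n s = t := by
  have hs : SupportedUpTo n ((cyc n)⁻¹ * t.perm * cyc n) :=
    ((supportedUpTo_cyc n).inv.mul ht).mul (supportedUpTo_cyc n)
  have hnoncrossing : Noncrossing ((cyc n)⁻¹ * t.perm * cyc n) :=
    t.noncrossing.inv_conj t.noncrossing t.noncrossing (cycle n).noncrossing ht.refines_cyc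
  refine ⟨⟨_, hnoncrossing, n, hs⟩, hs, ?_⟩
  ext1
  rw [perm_rotate hs]
  group

theorem rotate_sup (hs : SupportedUpTo n s.perm) (ht : SupportedUpTo n t.perm) :
    rotate n (s ⊔ t) = rotate n s ⊔ rotate n t := by
  have hst := supportedUpTo_sup hs ht
  obtain ⟨r, hr, hrst⟩ :=
    exists_rotate_eq (supportedUpTo_sup (supportedUpTo_rotate hs) (supportedUpTo_rotate ht))
  refine le_antisymm ?_ (sup_le (rotate_le_rotate hs hst le_sup_left)
    (rotate_le_rotate ht hst le_sup_right))
  rw [← hrst]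
  exact rotate_le_rotate hst hr (sup_le (le_of_rotate_le_rotate hs hr (hrst ▸ le_sup_left))
    (le_of_rotate_le_rotate ht hr (hrst ▸ le_sup_right)))

theorem rotate_one (n : ℕ) : rotate n 1 = 1 := by
  ext1
  rw [perm_rotate (.one n), perm_one, mul_one, mul_inv_cancel]

theorem rotate_res (hs : SupportedUpTo n s.perm) (ht : SupportedUpTo n t.perm) :
    rotate n (res s t) = res (rotate n s) (rotate n t) := by
  ext1
  rw [perm_rotate (supportedUpTo_res hs ht), perm_res, perm_res, ← rotate_sup hs ht,
    perm_rotate (supportedUpTo_sup hs ht), perm_rotate hs]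
  group

end NC

open NC

section Rotate

variable {n : ℕ} {s : NC} {u v : List NC}

theorem SupportedWord.map_rotate (hu : SupportedWord n u) :
    SupportedWord n (u.map (rotate n)) :=
  List.forall_mem_map.2 fun s hs => supportedUpTo_rotate (hu s hs)

theorem map_rotate_letterResWord (hs : SupportedUpTo n s.perm) (hu : SupportedWord n u) :
    (letterResWord s u).map (rotate n) = letterResWord (rotate n s) (u.map (rotate n)) := by
  induction u generalizing s with
  | nil => rfl
  | cons t u ih =>
    rw [SupportedWord.cons_iff] at hu
    simp only [letterResWord, List.map_cons]
    rw [rotate_res hs hu.1, ih (supportedUpTo_res hu.1 hs) hu.2, rotate_res hu.1 hs]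

theorem map_rotate_wordRes (hu : SupportedWord n u) (hv : SupportedWord n v) :
    (wordRes u v).map (rotate n) = wordRes (u.map (rotate n)) (v.map (rotate n)) := by
  induction u generalizing v with
  | nil => rfl
  | cons t u ih =>
    rw [SupportedWord.cons_iff] at hu
    rw [wordRes_cons, ih hu.2 (.letterResWord hu.1 hv), map_rotate_letterResWord hu.1 hv,
      List.map_cons, wordRes_cons]

theorem allOnes_map_rotate_iff (hu : SupportedWord n u) :
    AllOnes (u.map (rotate n)) ↔ AllOnes u := by
  refine List.forall_mem_map.trans (forall₂_congr fun s hs => ⟨fun h => ?_, fun h => ?_⟩)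
  · exact rotate_injective (hu s hs) (.one n) (h.trans (rotate_one n).symm)
  · rw [h, rotate_one]

theorem wordDvd_map_rotate_iff (hu : SupportedWord n u) (hv : SupportedWord n v) :
    WordDvd (u.map (rotate n)) (v.map (rotate n)) ↔ WordDvd u v := by
  rw [WordDvd, ← map_rotate_wordRes hv hu, allOnes_map_rotate_iff (hv.wordRes hu), WordDvd]

theorem mk_map_rotate_eq_iff (hu : SupportedWord n u) (hv : SupportedWord n v) :
    mk (u.map (rotate n)) = mk (v.map (rotate n)) ↔ mk u = mk v := by
  rw [mk_eq_mk, mk_eq_mk, WordEquiv, WordEquiv, wordDvd_map_rotate_iff hu hv,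
    wordDvd_map_rotate_iff hv hu]

theorem semiconjBy_of_cycle (hs : SupportedUpTo n s.perm) :
    SemiconjBy (of (cycle n)) (of s) (of (rotate n s)) := by
  have hle := le_cycle hs
  have hdiv := supportedUpTo_div hle (supportedUpTo_cyc n)
  have hrotate : of (rotate n s) * of (div (cycle n) s hle) = of (cycle n) := by
    refine of_mul_of (le_cycle hdiv) ?_
    rw [perm_rotate hs, perm_div, perm_cycle]
    group
  rw [SemiconjBy, ← of_div_mul_of hle, ← mul_assoc, hrotate, of_div_mul_of]

theorem semiconjBy_of_cycle_mk (hu : SupportedWord n u) :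
    SemiconjBy (of (cycle n)) (mk u) (mk (u.map (rotate n))) := by
  induction u with
  | nil => exact SemiconjBy.one_right _
  | cons s u ih =>
    rw [SupportedWord.cons_iff] at hu
    exact (ih hu.2).mul_right (semiconjBy_of_cycle hu.1)

theorem mk_eq_mk_of_cycle_pow_mul_eq (k : ℕ) (hu : SupportedWord n u) (hv : SupportedWord n v)
    (h : of (cycle n) ^ k * mk u = of (cycle n) ^ k * mk v) : mk u = mk v := by
  induction k generalizing u v with
  | zero => simpa only [pow_zero, one_mul] using h
  | succ k ih =>
    rw [pow_succ, mul_assoc, mul_assoc, semiconjBy_of_cycle_mk hu, semiconjBy_of_cycle_mk hv,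
      ← mul_assoc, ← mul_assoc] at h
    exact (mk_map_rotate_eq_iff hu hv).1 (ih hu.map_rotate hv.map_rotate (mul_right_cancel h))

theorem exists_mul_cycle_pow_mul_of_eq (k : ℕ) (hs : SupportedUpTo n s.perm) :
    ∃ x, x * of (cycle n) ^ k * of s = of (cycle n) ^ (k + 1) := by
  induction k generalizing s with
  | zero =>
    refine ⟨of (div (cycle n) s (le_cycle hs)), ?_⟩
    rw [pow_zero, mul_one, zero_add, pow_one, of_div_mul_of]
  | succ k ih =>
    obtain ⟨x, hx⟩ := ih (supportedUpTo_rotate hs)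
    refine ⟨x, ?_⟩
    calc x * of (cycle n) ^ (k + 1) * of s
        = x * of (cycle n) ^ k * (of (cycle n) * of s) := by rw [pow_succ]; simp only [mul_assoc]
      _ = x * of (cycle n) ^ k * of (rotate n s) * of (cycle n) := by
        rw [semiconjBy_of_cycle hs, mul_assoc _ (of (rotate n s))]
      _ = of (cycle n) ^ (k + 1 + 1) := by rw [hx, ← pow_succ]

theorem exists_mul_mk_eq_cycle_pow (hu : SupportedWord n u) :
    ∃ x k, x * mk u = of (cycle n) ^ k := by
  induction u with
  | nil => exact ⟨1, 0, rfl⟩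
  | cons s u ih =>
    rw [SupportedWord.cons_iff] at hu
    obtain ⟨x, k, hx⟩ := ih hu.2
    obtain ⟨y, hy⟩ := exists_mul_cycle_pow_mul_of_eq k hu.1
    exact ⟨y * x, k + 1, by rw [mk_cons, mul_assoc, ← mul_assoc x, hx, ← mul_assoc, hy]⟩

end Rotate

/-- Every element right-divides a power of a cycle, and those powers can be cancelled on the left
because they are quasi-central. -/
instance : IsLeftCancelMul (WordMonoid NC) where
  mul_left_cancel z x y h := by
    induction x using WordMonoid.ind with | mk u
    induction y using WordMonoid.ind with | mk v
    induction z using WordMonoid.ind with | mk w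
    obtain ⟨n, hwuv⟩ := exists_supportedWord (w ++ (u ++ v))
    simp only [SupportedWord.append_iff] at hwuv
    obtain ⟨x, k, hx⟩ := exists_mul_mk_eq_cycle_pow hwuv.1
    apply mk_eq_mk_of_cycle_pow_mul_eq k hwuv.2.1 hwuv.2.2
    rw [← hx, mul_assoc, mul_assoc]
    exact congrArg (x * ·) h

section FractionGroup

variable {S : Type*} [Complemented S]

noncomputable instance : OreLocalization.OreSet (⊤ : Submonoid (WordMonoid S)) where
  ore_right_cancel _ _ _ h := ⟨1, congrArg (1 * ·) (mul_right_cancel h)⟩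
  oreNum r s := (exists_common_left_mul r s.1).choose_spec.choose
  oreDenom r s := ⟨(exists_common_left_mul r s.1).choose, trivial⟩
  ore_eq r s := (exists_common_left_mul r s.1).choose_spec.choose_spec

variable (M : Type*) [Monoid M] [OreLocalization.OreSet (⊤ : Submonoid M)]

/-- The group of left fractions of a monoid that satisfies the Ore condition. -/
abbrev FractionGroup : Type _ := (OreLocalization (⊤ : Submonoid M) M)ˣ

variable {M}

/-- The canonical homomorphism from an Ore monoid to its group of left fractions. -/
def toFractionGroup : M →* FractionGroup M where
  toFun x := OreLocalization.numeratorUnit ⟨x, trivial⟩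
  map_one' := Units.ext (map_one OreLocalization.numeratorHom)
  map_mul' x y := Units.ext (map_mul OreLocalization.numeratorHom x y)

theorem toFractionGroup_injective [IsLeftCancelMul M] :
    Function.Injective (toFractionGroup : M → FractionGroup M) := by
  intro x y h
  obtain ⟨u, v, hmul, huv⟩ := OreLocalization.oreDiv_eq_iff.1 (congrArg Units.val h)
  have huv : (u : M) = v := by simpa using huv
  rw [Submonoid.smul_def, huv] at hmul
  exact (mul_left_cancel hmul).symm

end FractionGroup

/-! ### The relations between the Birman–Ko–Lee generators -/

section BirmanKoLee

variable {n p q r s i j k : ℕ}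

theorem σ_eq_of (h : 1 ≤ i ∧ i < n) : σ n i = PresentedGroup.of ⟨i, h⟩ := dif_pos h

theorem σ_commute_σ (n : ℕ) (hij : i + 2 ≤ j) : Commute (σ n i) (σ n j) := by
  by_cases hi : 1 ≤ i ∧ i < n
  · by_cases hj : 1 ≤ j ∧ j < n
    · have h : PresentedGroup.mk (artinRels n) _ = 1 := PresentedGroup.one_of_mem
        (Or.inl ⟨⟨i, hi⟩, ⟨j, hj⟩, Or.inl hij, rfl⟩)
      rw [map_mul, map_inv, mul_inv_eq_one, map_mul, map_mul] at h
      rw [σ_eq_of hi, σ_eq_of hj]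
      exact h
    · rw [σ.eq_1 n j, dif_neg hj]
      exact Commute.one_right _
  · rw [σ.eq_1 n i, dif_neg hi]
    exact Commute.one_left _

theorem σ_mul_σ_succ_mul_σ (hi : 1 ≤ i) (hn : i + 1 < n) :
    σ n i * σ n (i + 1) * σ n i = σ n (i + 1) * σ n i * σ n (i + 1) := by
  rw [σ_eq_of ⟨hi, by omega⟩, σ_eq_of ⟨by omega, hn⟩]
  have h : PresentedGroup.mk (artinRels n) _ = 1 := PresentedGroup.one_of_mem
    (Or.inr ⟨⟨i, hi, by omega⟩, ⟨i + 1, by omega, hn⟩, Or.inl rfl, rfl⟩)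
  rw [map_mul, map_inv, mul_inv_eq_one, map_mul, map_mul, map_mul, map_mul] at h
  exact h

theorem sigmaProd_self (n p : ℕ) : sigmaProd n p p = 1 := by simp [sigmaProd]

theorem sigmaProd_mul_sigmaProd (n : ℕ) (hpq : p ≤ q) (hqr : q ≤ r) :
    sigmaProd n p q * sigmaProd n q r = sigmaProd n p r := by
  rw [sigmaProd, sigmaProd, sigmaProd, ← List.Ico.append_consecutive hpq hqr, List.map_append,
    List.prod_append]

theorem sigmaProd_self_succ (n p : ℕ) : sigmaProd n p (p + 1) = σ n p := by simp [sigmaProd]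

theorem commute_sigmaProd {x : B n} (h : ∀ j, p ≤ j → j < q → Commute x (σ n j)) :
    Commute x (sigmaProd n p q) := by
  refine Commute.list_prod_right _ _ fun y hy => ?_
  obtain ⟨j, hj, rfl⟩ := List.mem_map.1 hy
  rw [List.Ico.mem] at hj
  exact h j hj.1 hj.2

theorem commute_a {x : B n} (hpq : p < q) (h : ∀ j, p ≤ j → j < q → Commute x (σ n j)) :
    Commute x (a n p q) := by
  have hprod := commute_sigmaProd (q := q - 1) fun j hpj hjq => h j hpj (by omega)
  exact (hprod.mul_right (h (q - 1) (by omega) (by omega))).mul_right hprod.inv_right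

theorem a_self_succ (n p : ℕ) : a n p (p + 1) = σ n p := by
  rw [a, Nat.add_sub_cancel, sigmaProd_self, one_mul, inv_one, mul_one]

theorem a_eq_conj_sigmaProd (n : ℕ) (hpk : p ≤ k) (hkq : k < q) :
    a n p q = sigmaProd n p k * a n k q * (sigmaProd n p k)⁻¹ := by
  rw [a, a, ← sigmaProd_mul_sigmaProd n hpk (Nat.le_sub_one_of_lt hkq)]
  group

theorem a_eq_conj_σ (n : ℕ) (hpq : p + 1 < q) :
    a n p q = σ n p * a n (p + 1) q * (σ n p)⁻¹ := by
  rw [a_eq_conj_sigmaProd n p.le_succ hpq, sigmaProd_self_succ]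

theorem a_commute_a_of_lt (n : ℕ) (hpq : p < q) (hqr : q < r) (hrs : r < s) :
    Commute (a n p q) (a n r s) :=
  commute_a hrs fun _ _ _ => (commute_a hpq fun _ _ _ => (σ_commute_σ n (by omega)).symm).symm

theorem σ_commute_a_of_lt (hp : 1 ≤ p) (hpj : p < j) (hjq : j + 1 < q) (hq : q ≤ n) :
    Commute (σ n j) (a n p q) := by
  obtain ⟨i, rfl⟩ := Nat.exists_eq_add_one.2 (Nat.zero_lt_of_lt hpj)
  have hprod : Commute (σ n (i + 1)) (sigmaProd n p i) :=
    commute_sigmaProd fun j _ _ => (σ_commute_σ n (by omega)).symm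
  have hbase : Commute (σ n (i + 1)) (a n i q) := by
    have hσ : σ n i * σ n (i + 1) * σ n i * (σ n i * σ n (i + 1))⁻¹ = σ n (i + 1) := by
      rw [σ_mul_σ_succ_mul_σ (by omega) (by omega)]
      group
    have hcomm : Commute (σ n i) (a n (i + 1 + 1) q) :=
      commute_a hjq fun j _ _ => σ_commute_σ n (by omega)
    have hconj := (Commute.conj_iff (σ n i * σ n (i + 1))).2 hcomm
    rw [hσ] at hconj
    rw [a_eq_conj_σ n (by omega), a_eq_conj_σ n hjq]
    convert hconj using 1
    group
  rw [a_eq_conj_sigmaProd n (Nat.le_of_lt_succ hpj) (by omega)]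
  exact (hprod.mul_right hbase).mul_right hprod.inv_right

theorem a_commute_a_of_nested (hp : 1 ≤ p) (hpr : p < r) (hrs : r < s) (hsq : s < q)
    (hq : q ≤ n) : Commute (a n p q) (a n r s) :=
  commute_a hrs fun _ _ _ => (σ_commute_a_of_lt hp (by omega) (by omega) hq).symm

theorem a_succ_eq_conj_σ (hp : 1 ≤ p) (hpq : p < q) (hq : q < n) :
    a n p (q + 1) = (σ n q)⁻¹ * a n p q * σ n q := by
  obtain ⟨i, rfl⟩ := Nat.exists_eq_add_one.2 (Nat.zero_lt_of_lt hpq)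
  have hpi : p ≤ i := Nat.le_of_lt_succ hpq
  have hprod : Commute (sigmaProd n p i) (σ n (i + 1))⁻¹ :=
    (commute_sigmaProd fun j _ _ => (σ_commute_σ n (by omega)).symm).symm.inv_right
  have hbase : a n i (i + 1 + 1) = (σ n (i + 1))⁻¹ * σ n i * σ n (i + 1) := by
    rw [a_eq_conj_σ n (by omega), a_self_succ, mul_inv_eq_iff_eq_mul, mul_assoc, mul_assoc,
      eq_inv_mul_iff_mul_eq, ← mul_assoc, ← mul_assoc]
    exact (σ_mul_σ_succ_mul_σ (by omega) hq).symm
  calc a n p (i + 1 + 1)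
      = sigmaProd n p i * ((σ n (i + 1))⁻¹ * σ n i * σ n (i + 1)) * (sigmaProd n p i)⁻¹ := by
        rw [a_eq_conj_sigmaProd n hpi (by omega), hbase]
    _ = sigmaProd n p i * (σ n (i + 1))⁻¹ * σ n i * (sigmaProd n p i * (σ n (i + 1))⁻¹)⁻¹ := by
        group
    _ = (σ n (i + 1))⁻¹ * (sigmaProd n p i * σ n i * (sigmaProd n p i)⁻¹) * σ n (i + 1) := by
        rw [hprod.eq]
        group
    _ = (σ n (i + 1))⁻¹ * a n p (i + 1) * σ n (i + 1) := by rw [a, Nat.add_sub_cancel]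

theorem a_triangle_left (n : ℕ) (hpq : p < q) (hqr : q < r) :
    a n p r * a n p q = a n p q * a n q r := by
  obtain ⟨i, rfl⟩ := Nat.exists_eq_add_one.2 (Nat.zero_lt_of_lt hpq)
  have hpi : p ≤ i := Nat.le_of_lt_succ hpq
  have hprod : Commute (sigmaProd n p i) (a n (i + 1) r) :=
    commute_a hqr fun j _ _ => (commute_sigmaProd fun k _ _ => (σ_commute_σ n (by omega)).symm).symm
  rw [a_eq_conj_sigmaProd n hpi (Nat.lt_of_succ_lt hqr), a_eq_conj_σ n hqr,
    a_eq_conj_sigmaProd n hpi i.lt_succ_self, a_self_succ, mul_assoc _ _ (a n (i + 1) r),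
    hprod.inv_left.eq]
  group

theorem a_triangle_right (hp : 1 ≤ p) (hpq : p < q) (hqr : q < r) (hr : r ≤ n) :
    a n p q * a n q r = a n q r * a n p r := by
  induction r, hqr using Nat.le_induction with
  | base =>
    rw [a_self_succ, a_succ_eq_conj_σ hp hpq hr, mul_assoc, mul_inv_cancel_left]
  | succ r hqr ih =>
    have hσ : Commute (a n p q) (σ n r)⁻¹ :=
      (commute_a hpq fun j _ _ => (σ_commute_σ n (by omega)).symm).symm.inv_right
    rw [a_succ_eq_conj_σ (by omega) hqr hr,
      a_succ_eq_conj_σ hp (by omega) hr]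
    calc a n p q * ((σ n r)⁻¹ * a n q r * σ n r)
        = (σ n r)⁻¹ * (a n p q * a n q r) * σ n r := by
          rw [mul_assoc, ← mul_assoc, hσ.eq]
          group
      _ = (σ n r)⁻¹ * a n q r * σ n r * ((σ n r)⁻¹ * a n p r * σ n r) := by
          rw [ih (by omega)]
          group

end BirmanKoLee

section Transposition

variable {n p q r s : ℕ} {t : NC}

theorem refines_swap_iff {t : Perm ℕ} : Refines (swap p q) t ↔ SameBlock t p q := by
  constructor
  · intro h
    simpa only [swap_apply_left] using h p
  · intro h j
    rw [swap_apply_def]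
    split_ifs with hjp hjq
    · exact hjp ▸ h
    · exact hjq ▸ h.symm
    · exact SameBlock.refl t j

theorem noncrossing_swap (p q : ℕ) : Noncrossing (swap p q) := by
  rw [Noncrossing, refines_swap_iff]
  intro k
  rw [swap_apply_def]
  unfold InGap; grind

theorem supportedUpTo_swap (hp : 1 ≤ p ∧ p ≤ n) (hq : 1 ≤ q ∧ q ≤ n) :
    SupportedUpTo n (swap p q) :=
  fun _ _ => swap_apply_of_ne_of_ne (by omega) (by omega)

/-- The transposition `(p q)` as a noncrossing permutation, for `p, q ≥ 1` (and `1` otherwise). It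
is the simple element `a_{p,q}`. -/
def NC.transposition (p q : ℕ) : NC :=
  if h : 1 ≤ p ∧ 1 ≤ q then
    { perm := swap p q
      noncrossing := noncrossing_swap p q
      exists_supportedUpTo := ⟨max p q,
        supportedUpTo_swap ⟨h.1, le_max_left p q⟩ ⟨h.2, le_max_right p q⟩⟩ }
  else 1

theorem NC.perm_transposition (hp : 1 ≤ p) (hq : 1 ≤ q) :
    (transposition p q).perm = swap p q := by
  rw [transposition, dif_pos ⟨hp, hq⟩]

theorem NC.supportedUpTo_transposition (hp : 1 ≤ p ∧ p ≤ n) (hq : 1 ≤ q ∧ q ≤ n) :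
    SupportedUpTo n (transposition p q).perm := by
  rw [perm_transposition hp.1 hq.1]
  exact supportedUpTo_swap hp hq

theorem NC.transposition_le_iff (hp : 1 ≤ p) (hq : 1 ≤ q) :
    transposition p q ≤ t ↔ SameBlock t.perm p q := by
  rw [le_def, perm_transposition hp hq, refines_swap_iff]

theorem of_transposition_mul_of_transposition {p' q' : ℕ} (hp : 1 ≤ p) (hq : 1 ≤ q)
    (hp' : 1 ≤ p') (hq' : 1 ≤ q') (h : SameBlock t.perm p q)
    (ht : t.perm = swap p' q' * swap p q) :
    of (transposition p' q') * of (transposition p q) = of t := by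
  refine of_mul_of ((transposition_le_iff hp hq).2 h) ?_
  rw [perm_transposition hp hq, perm_transposition hp' hq', ht]

theorem noncrossing_swap_mul_swap (hpq : p < q) (hqr : q < r) :
    Noncrossing (swap p q * swap q r) := by
  intro j k
  simp only [Perm.mul_apply, swap_apply_def]
  unfold InGap; grind

theorem noncrossing_swap_mul_swap_of_lt (hpq : p < q) (hqr : q < r) (hrs : r < s) :
    Noncrossing (swap p q * swap r s) := by
  intro j k
  simp only [Perm.mul_apply, swap_apply_def]
  unfold InGap; grind

theorem of_transposition_triangle (hp : 1 ≤ p) (hpq : p < q) (hqr : q < r) :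
    of (transposition p r) * of (transposition p q) =
        of (transposition p q) * of (transposition q r) ∧
      of (transposition p q) * of (transposition q r) =
        of (transposition q r) * of (transposition p r) := by
  have hnc := noncrossing_swap_mul_swap hpq hqr
  let t : NC :=
    { perm := swap p q * swap q r
      noncrossing := hnc
      exists_supportedUpTo := ⟨r, (supportedUpTo_swap (by omega) (by omega)).mul
        (supportedUpTo_swap (by omega) (by omega))⟩ }
  have hblock_pq : SameBlock t.perm p q := by
    simpa [swap_apply_of_ne_of_ne hpq.ne (hpq.trans hqr).ne] using hnc p
  have hblock_qr : SameBlock t.perm q r := by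
    simpa [swap_apply_of_ne_of_ne (hpq.trans hqr).ne' hqr.ne'] using hnc q
  have hleft : swap p q * swap q r = swap p r * swap p q := by
    rw [mul_swap_eq_swap_mul, swap_apply_right,
      swap_apply_of_ne_of_ne (hpq.trans hqr).ne' hqr.ne']
  have hright : swap q r * swap p r = swap p q * swap q r := by
    rw [mul_swap_eq_swap_mul, swap_apply_right,
      swap_apply_of_ne_of_ne hpq.ne (hpq.trans hqr).ne]
  have hmul := of_transposition_mul_of_transposition (t := t) (by omega) (by omega) hp (by omega)
    hblock_qr rfl
  exact ⟨(of_transposition_mul_of_transposition hp (by omega) hp (by omega) hblock_pq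
    hleft).trans hmul.symm, hmul.trans (of_transposition_mul_of_transposition hp (by omega)
    (by omega) (by omega) (hblock_pq.trans hblock_qr) hright.symm).symm⟩

theorem commute_of_transposition (hp : 1 ≤ p) (hpq : p < q) (hqr : q < r) (hrs : r < s) :
    Commute (of (transposition p q)) (of (transposition r s)) := by
  have hnc := noncrossing_swap_mul_swap_of_lt hpq hqr hrs
  let t : NC :=
    { perm := swap p q * swap r s
      noncrossing := hnc
      exists_supportedUpTo := ⟨s, (supportedUpTo_swap (by omega) (by omega)).mul
        (supportedUpTo_swap (by omega) (by omega))⟩ }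
  have hblock_pq : SameBlock t.perm p q := by
    simpa [swap_apply_of_ne_of_ne (a := r) (b := s) (x := p) (by omega) (by omega)] using hnc p
  have hblock_rs : SameBlock t.perm r s := by
    simpa [swap_apply_of_ne_of_ne (a := p) (b := q) (x := s) (by omega) (by omega)] using hnc r
  have hcomm : swap p q * swap r s = swap r s * swap p q := by
    rw [mul_swap_eq_swap_mul, swap_apply_of_ne_of_ne (by omega) (by omega),
      swap_apply_of_ne_of_ne (by omega) (by omega)]
  exact (of_transposition_mul_of_transposition (t := t) (by omega) (by omega) hp (by omega)
    hblock_rs rfl).trans (of_transposition_mul_of_transposition (t := t) hp (by omega) (by omega)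
    (by omega) hblock_pq hcomm).symm

end Transposition

section ToFraction

variable {n p q i : ℕ}

/-- The image of `σᵢ` in the group of fractions of the noncrossing words. -/
noncomputable def fractionσ (i : ℕ) : FractionGroup (WordMonoid NC) :=
  toFractionGroup (of (transposition i (i + 1)))

theorem fractionσ_braid (hi : 1 ≤ i) :
    fractionσ i * fractionσ (i + 1) * fractionσ i =
      fractionσ (i + 1) * fractionσ i * fractionσ (i + 1) := by
  obtain ⟨hleft, hright⟩ := of_transposition_triangle hi i.lt_succ_self (i + 1).lt_succ_self
  simp only [fractionσ, ← map_mul]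
  rw [hright, mul_assoc, hleft, mul_assoc]

theorem commute_fractionσ {j : ℕ} (hi : 1 ≤ i) (hij : i + 2 ≤ j) :
    Commute (fractionσ i) (fractionσ j) :=
  (commute_of_transposition hi i.lt_succ_self hij j.lt_succ_self).map toFractionGroup

theorem fractionσ_rels (n : ℕ) :
    ∀ r ∈ artinRels n, FreeGroup.lift (fun i : Idx n => fractionσ i.1) r = 1 := by
  rintro r (⟨⟨i, hi⟩, ⟨j, hj⟩, hij | hij, rfl⟩ | ⟨⟨i, hi⟩, ⟨j, hj⟩, hij, rfl⟩)
  all_goals simp only [map_mul, map_inv, FreeGroup.lift_apply_of]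
  all_goals rw [mul_inv_eq_one]
  · exact commute_fractionσ hi.1 hij
  · exact (commute_fractionσ hj.1 hij).symm
  · rcases hij with rfl | rfl
    · exact fractionσ_braid hi.1
    · exact (fractionσ_braid hj.1).symm

/-- The homomorphism from the braid group to the group of fractions of the noncrossing words. It
detects the equality of words in `BKLₙ`. -/
noncomputable def toFraction (n : ℕ) : B n →* FractionGroup (WordMonoid NC) :=
  PresentedGroup.toGroup (fractionσ_rels n)

theorem toFraction_σ (h : 1 ≤ i ∧ i < n) : toFraction n (σ n i) = fractionσ i := by
  rw [σ_eq_of h]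
  exact PresentedGroup.toGroup.of (fractionσ_rels n)

theorem toFraction_a (hp : 1 ≤ p) (hpq : p < q) (hq : q ≤ n) :
    toFraction n (a n p q) = toFractionGroup (of (transposition p q)) := by
  obtain ⟨i, rfl⟩ := Nat.exists_eq_add_one.2 (Nat.zero_lt_of_lt hpq)
  have hpi : p ≤ i := Nat.le_of_lt_succ hpq
  induction hpi using Nat.decreasingInduction with
  | self => rw [a_self_succ, toFraction_σ ⟨hp, hq⟩, fractionσ]
  | of_succ p hpi ih =>
    rw [a_eq_conj_σ n (by omega), map_mul, map_mul, map_inv, ih (by omega) (by omega),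
      toFraction_σ ⟨hp, by omega⟩, mul_inv_eq_iff_eq_mul, fractionσ, ← map_mul, ← map_mul,
      (of_transposition_triangle hp p.lt_succ_self (by omega)).1]

end ToFraction

/-! ### Words representing braids -/

section SimpleBraids

variable {n p q k l m : ℕ} {s t : Perm ℕ}

/-- The factor `a_{i,j}` that an ascending arc from `i` to `j` contributes to a simple braid; it
is `1` for `j ≤ i`. -/
def arc (n i j : ℕ) : B n := if i < j then a n i j else 1

theorem arc_of_lt (n : ℕ) (h : p < q) : arc n p q = a n p q := if_pos h

theorem arc_of_le (n : ℕ) (h : q ≤ p) : arc n p q = 1 := if_neg h.not_gt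

/-- The product of the arcs `i → t i` that start in `{l, …, m - 1}`, in increasing order. -/
def arcProd (n : ℕ) (t : Perm ℕ) (l m : ℕ) : B n :=
  ((List.Ico l m).map fun i => arc n i (t i)).prod

theorem arcProd_mul_arcProd (n : ℕ) (t : Perm ℕ) (hlm : l ≤ m) (hmk : m ≤ k) :
    arcProd n t l m * arcProd n t m k = arcProd n t l k := by
  rw [arcProd, arcProd, arcProd, ← List.Ico.append_consecutive hlm hmk, List.map_append,
    List.prod_append]

theorem arc_mul_arcProd (n : ℕ) (t : Perm ℕ) (hlm : l < m) :
    arc n l (t l) * arcProd n t (l + 1) m = arcProd n t l m := by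
  rw [arcProd, arcProd, List.Ico.eq_cons hlm, List.map_cons, List.prod_cons]

theorem arcProd_congr (n : ℕ) (h : ∀ i, l ≤ i → i < m → s i = t i) :
    arcProd n s l m = arcProd n t l m := by
  rw [arcProd, arcProd]
  refine congrArg List.prod (List.map_congr_left fun i hi => ?_)
  rw [List.Ico.mem] at hi
  rw [h i hi.1 hi.2]

theorem commute_arcProd {x : B n}
    (h : ∀ i, l ≤ i → i < m → i < t i → Commute x (a n i (t i))) :
    Commute x (arcProd n t l m) := by
  refine Commute.list_prod_right _ _ fun y hy => ?_
  obtain ⟨i, hi, rfl⟩ := List.mem_map.1 hy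
  rw [List.Ico.mem] at hi
  rcases lt_or_ge i (t i) with hti | hti
  · rw [arc_of_lt n hti]
    exact h i hi.1 hi.2 hti
  · rw [arc_of_le n hti]
    exact Commute.one_right x

theorem commute_a_arcProd_of_noncrossing (ht : Noncrossing t) (hp : 1 ≤ p) (hpk : p ≤ k)
    (hn : t k ≤ n) : Commute (a n p (t k)) (arcProd n t (k + 1) (t k)) := by
  refine commute_arcProd fun i hki hik hti => ?_
  have hle : t i ≤ t k := (ht k).apply_le_of_between (by omega) hik hti.le
  have hne : t i ≠ t k := fun h => by
    have := t.injective h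
    omega
  exact a_commute_a_of_nested hp (by omega) hti (by omega) hn

/-- `a_{p,q}` slides through the arcs between two points of the same block: it commutes with the
arcs nested below it, and is prolonged by the arcs that start at its end point. -/
theorem a_mul_arcProd_of_sameBlock (ht : Noncrossing t) (h : SameBlock t k q) (hp : 1 ≤ p)
    (hpk : p ≤ k) (hkq : k < q) (hq : q ≤ n) :
    a n p (t k) * arcProd n t (k + 1) q = arcProd n t (k + 1) q * a n p q := by
  induction hd : q - k using Nat.strong_induction_on generalizing k with
  | _ d ih =>
    have hlt := h.lt_apply hkq
    have hcomm := commute_a_arcProd_of_noncrossing (n := n) ht hp hpk ((h.apply_le hkq).trans hq)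
    rcases (h.apply_le hkq).eq_or_lt with heq | hlt_q
    · rw [heq] at hcomm ⊢
      exact hcomm
    · have hblock : SameBlock t (t k) q := (ht k).symm.trans h
      have hlt' := hblock.lt_apply hlt_q
      have htriangle := a_triangle_right hp (by omega) hlt'
        ((hblock.apply_le hlt_q).trans hq)
      rw [← arcProd_mul_arcProd n t hlt hlt_q.le, ← arc_mul_arcProd n t hlt_q, arc_of_lt n hlt',
        ← mul_assoc, hcomm.eq, mul_assoc, ← mul_assoc (a n p (t k)), htriangle, mul_assoc,
        ih (q - t k) (by omega) hblock (by omega) hlt_q rfl]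
      simp only [mul_assoc]

theorem a_mul_arcProd_mul_arc (ht : Noncrossing t) (h : SameBlock t p q) (hp : 1 ≤ p)
    (hpq : p < q) (hq : q ≤ n) (htq : t q ≤ n) :
    a n p (t p) * arcProd n t (p + 1) q * arc n q (t q) =
      arc n p (t q) * arcProd n t (p + 1) q * a n p q := by
  rw [a_mul_arcProd_of_sameBlock ht h hp le_rfl hpq hq]
  rcases h.lt_apply_or_apply_le with hlt | hle
  · have hcomm : Commute (a n p (t q)) (arcProd n t (p + 1) q) := by
      refine commute_arcProd fun i hpi hiq hti => ?_
      have hle := h.apply_le_of_between hpi hiq hti.le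
      exact a_commute_a_of_nested hp hpi hti (by omega) htq
    rw [arc_of_lt n hlt, arc_of_lt n (hpq.trans hlt), hcomm.eq, mul_assoc, mul_assoc,
      a_triangle_left n hpq hlt]
  · rw [arc_of_le n hle, arc_of_le n (hle.trans hpq.le), one_mul, mul_one]

theorem arcProd_eq_mul_arc_mul_arc (t : Perm ℕ) (hp : 1 ≤ p) (hpq : p < q) (hq : q ≤ n) :
    arcProd n t 1 (n + 1) = arcProd n t 1 p * (arc n p (t p) * arcProd n t (p + 1) q *
      arc n q (t q)) * arcProd n t (q + 1) (n + 1) := by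
  rw [← arcProd_mul_arcProd n t hp (by omega : p ≤ n + 1),
    ← arcProd_mul_arcProd n t hpq.le (by omega : q ≤ n + 1), ← arc_mul_arcProd n t hpq,
    ← arc_mul_arcProd n t (Nat.lt_succ_of_le hq)]
  simp only [mul_assoc]

theorem arcProd_mul_swap (htn : SupportedUpTo n t) (ht : Noncrossing t) (h : SameBlock t p q)
    (hp : 1 ≤ p) (hpq : p < q) (hq : q ≤ n) :
    arcProd n (t * swap p q) 1 (n + 1) * a n p q = arcProd n t 1 (n + 1) := by
  have hcongr : ∀ l m, (∀ i, l ≤ i → i < m → i ≠ p ∧ i ≠ q) →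
      arcProd n (t * swap p q) l m = arcProd n t l m := fun l m hlm =>
    arcProd_congr n fun i hi hi' => by
      rw [Perm.mul_apply, swap_apply_of_ne_of_ne (hlm i hi hi').1 (hlm i hi hi').2]
  have hcomm : Commute (arcProd n t (q + 1) (n + 1)) (a n p q) :=
    (commute_arcProd fun i hqi _ hti => a_commute_a_of_lt n hpq hqi hti).symm
  rw [arcProd_eq_mul_arc_mul_arc _ hp hpq hq, arcProd_eq_mul_arc_mul_arc t hp hpq hq,
    hcongr 1 p (by omega), hcongr (p + 1) q (by omega), hcongr (q + 1) (n + 1) (by omega),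
    Perm.mul_apply, Perm.mul_apply, swap_apply_left, swap_apply_right,
    arc_of_le n (h.apply_le hpq), arc_of_lt n (h.lt_apply hpq), mul_one, mul_assoc _ _ (a n p q),
    hcomm.eq, a_mul_arcProd_mul_arc ht h hp hpq hq (htn.apply_mem ⟨by omega, hq⟩).2]
  simp only [mul_assoc]

end SimpleBraids

section SimpleBraid

variable {n p q : ℕ} {s t : NC}

/-- The simple braid of `BKLₙ` that corresponds to a noncrossing permutation. -/
def simpleBraid (n : ℕ) (t : NC) : B n := arcProd n t.perm 1 (n + 1)

theorem simpleBraid_one (n : ℕ) : simpleBraid n 1 = 1 := by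
  refine List.prod_eq_one fun x hx => ?_
  obtain ⟨i, -, rfl⟩ := List.mem_map.1 hx
  exact arc_of_le n le_rfl

theorem simpleBraid_div_transposition_mul (ht : SupportedUpTo n t.perm) (hp : 1 ≤ p)
    (hpq : p < q) (hq : q ≤ n) (h : transposition p q ≤ t) :
    simpleBraid n (div t (transposition p q) h) * a n p q = simpleBraid n t := by
  have hq' : 1 ≤ q := hp.trans hpq.le
  rw [simpleBraid, perm_div, perm_transposition hp hq', swap_inv,
    arcProd_mul_swap ht t.noncrossing ((transposition_le_iff hp hq').1 h) hp hpq hq, simpleBraid]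

/-- Dividing `s` by the transposition of its largest moved point and the preimage of that point
yields a permutation that fixes it. -/
@[elab_as_elim]
theorem NC.transposition_induction {P : ∀ s : NC, SupportedUpTo n s.perm → Prop}
    (one : P 1 (.one n))
    (mul_transposition : ∀ (s : NC) (hs : SupportedUpTo n s.perm) (p q : ℕ), 1 ≤ p → p < q →
      q ≤ n → ∀ hle : transposition p q ≤ s,
        P (div s (transposition p q) hle) (supportedUpTo_div hle hs) → P s hs)
    (s : NC) (hs : SupportedUpTo n s.perm) : P s hs := by
  suffices h : ∀ m ≤ n, ∀ s (hs : SupportedUpTo n s.perm), SupportedUpTo m s.perm → P s hs from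
    h n le_rfl s hs hs
  intro m
  induction m with
  | zero =>
    intro _ s hs hs₀
    obtain rfl : s = 1 := NC.ext (Equiv.ext fun i => hs₀ i (by omega))
    exact one
  | succ m ih =>
    intro hmn s hs hsm
    obtain ⟨p, hp⟩ := s.perm.surjective (m + 1)
    have hp_mem : 1 ≤ p ∧ p ≤ m + 1 := by
      by_contra h
      rw [hsm p h] at hp
      omega
    rcases hp_mem.2.eq_or_lt with rfl | hlt
    · refine ih (by omega) s hs fun i hi => ?_
      by_cases him : i = m + 1
      · rw [him, hp]
      · exact hsm i (by omega)
    · have hblock : SameBlock s.perm p (m + 1) := hp ▸ s.noncrossing p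
      have hle := (transposition_le_iff hp_mem.1 (Nat.succ_pos m)).2 hblock
      refine mul_transposition s hs p (m + 1) hp_mem.1 hlt hmn hle
        (ih (by omega) _ _ fun i hi => ?_)
      by_cases him : i = m + 1
      · rw [perm_div, perm_transposition hp_mem.1 (Nat.succ_pos m), swap_inv, him,
          Perm.mul_apply, swap_apply_right, hp]
      · exact supportedUpTo_div hle hsm i (by omega)

theorem simpleBraid_div_mul (hs : SupportedUpTo n s.perm) (ht : SupportedUpTo n t.perm)
    (h : s ≤ t) : simpleBraid n (div t s h) * simpleBraid n s = simpleBraid n t := by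
  induction s, hs using NC.transposition_induction generalizing t with
  | one =>
    have hdiv : div t 1 h = t := NC.ext (by rw [perm_div, perm_one, inv_one, mul_one])
    rw [simpleBraid_one, mul_one, hdiv]
  | mul_transposition s hs p q hp hpq hq hle ih =>
    have hdiv : div (div t _ (hle.trans h)) _ (div_le_div hle h) = div t s h := by
      ext1
      simp only [perm_div]
      group
    rw [← simpleBraid_div_transposition_mul hs hp hpq hq hle,
      ← simpleBraid_div_transposition_mul ht hp hpq hq (hle.trans h),
      ← ih (supportedUpTo_div (hle.trans h) ht) (div_le_div hle h), hdiv, mul_assoc]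

theorem simpleBraid_transposition (hp : 1 ≤ p) (hpq : p < q) (hq : q ≤ n) :
    simpleBraid n (transposition p q) = a n p q := by
  have hdiv : div (transposition p q) (transposition p q) le_rfl = 1 :=
    NC.ext (mul_inv_cancel _)
  rw [← simpleBraid_div_transposition_mul
    (supportedUpTo_transposition (by omega) (by omega)) hp hpq hq le_rfl, hdiv, simpleBraid_one,
    one_mul]

theorem simpleBraid_res_mul (hs : SupportedUpTo n s.perm) (ht : SupportedUpTo n t.perm) :
    simpleBraid n (res s t) * simpleBraid n s = simpleBraid n (res t s) * simpleBraid n t := by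
  refine (simpleBraid_div_mul hs (supportedUpTo_sup hs ht) le_sup_left).trans ?_
  rw [sup_comm]
  exact (simpleBraid_div_mul ht (supportedUpTo_sup ht hs) le_sup_left).symm

theorem toFraction_simpleBraid (hs : SupportedUpTo n s.perm) :
    toFraction n (simpleBraid n s) = toFractionGroup (of s) := by
  induction s, hs using NC.transposition_induction with
  | one => rw [simpleBraid_one, of_one, map_one, map_one]
  | mul_transposition s hs p q hp hpq hq hle ih =>
    rw [← simpleBraid_div_transposition_mul hs hp hpq hq hle, map_mul, ih,
      toFraction_a hp hpq hq, ← map_mul, of_div_mul_of]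

theorem a_mem_BKL (hp : 1 ≤ p) (hpq : p < q) (hq : q ≤ n) : a n p q ∈ BKL n :=
  Submonoid.subset_closure ⟨p, q, hp, hpq, hq, rfl⟩

theorem simpleBraid_mem_BKL (hs : SupportedUpTo n s.perm) : simpleBraid n s ∈ BKL n := by
  induction s, hs using NC.transposition_induction with
  | one =>
    rw [simpleBraid_one]
    exact one_mem _
  | mul_transposition s hs p q hp hpq hq hle ih =>
    rw [← simpleBraid_div_transposition_mul hs hp hpq hq hle]
    exact mul_mem ih (a_mem_BKL hp hpq hq)

end SimpleBraid

section WordBraid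

variable {n : ℕ} {s : NC} {u v : List NC} {x : B n}

/-- The braid represented by a word in the simple braids, read from right to left. -/
def wordBraid (n : ℕ) : List NC → B n
  | [] => 1
  | s :: u => wordBraid n u * simpleBraid n s

theorem wordBraid_singleton (n : ℕ) (s : NC) : wordBraid n [s] = simpleBraid n s := one_mul _

theorem wordBraid_append (n : ℕ) (u v : List NC) :
    wordBraid n (u ++ v) = wordBraid n v * wordBraid n u := by
  induction u with
  | nil => exact (mul_one _).symm
  | cons s u ih => rw [List.cons_append, wordBraid, wordBraid, ih, mul_assoc]

theorem wordBraid_eq_one_of_allOnes (n : ℕ) (h : AllOnes u) : wordBraid n u = 1 := by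
  induction u with
  | nil => rfl
  | cons s u ih =>
    obtain ⟨rfl, hu⟩ := allOnes_cons.1 h
    rw [wordBraid, ih hu, simpleBraid_one, mul_one]

theorem wordBraid_letterResWord_mul (hs : SupportedUpTo n s.perm) (hu : SupportedWord n u) :
    wordBraid n (letterResWord s u) * simpleBraid n s =
      simpleBraid n (wordResLetter u s) * wordBraid n u := by
  induction u generalizing s with
  | nil => simp [letterResWord, wordResLetter, wordBraid]
  | cons t u ih =>
    rw [SupportedWord.cons_iff] at hu
    rw [letterResWord, wordBraid, mul_assoc, simpleBraid_res_mul hs hu.1, ← mul_assoc,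
      ih (supportedUpTo_res hu.1 hs) hu.2, wordResLetter, wordBraid, mul_assoc]

theorem wordBraid_wordRes_mul (hu : SupportedWord n u) (hv : SupportedWord n v) :
    wordBraid n (wordRes u v) * wordBraid n u = wordBraid n (wordRes v u) * wordBraid n v := by
  induction u generalizing v with
  | nil => simp [wordRes_nil, wordRes, wordBraid]
  | cons s u ih =>
    rw [SupportedWord.cons_iff] at hu
    rw [wordRes_cons, wordRes_cons_right, wordBraid, wordBraid, ← mul_assoc,
      ih hu.2 (.letterResWord hu.1 hv), mul_assoc, wordBraid_letterResWord_mul hu.1 hv, mul_assoc]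

theorem toFraction_wordBraid (hu : SupportedWord n u) :
    toFraction n (wordBraid n u) = toFractionGroup (mk u) := by
  induction u with
  | nil => rw [wordBraid, mk_nil, map_one, map_one]
  | cons s u ih =>
    rw [SupportedWord.cons_iff] at hu
    rw [wordBraid, map_mul, ih hu.2, toFraction_simpleBraid hu.1, mk_cons, map_mul]

theorem wordBraid_eq_iff (hu : SupportedWord n u) (hv : SupportedWord n v) :
    wordBraid n u = wordBraid n v ↔ WordEquiv u v := by
  constructor
  · intro h
    have hfraction := congrArg (toFraction n) h
    rw [toFraction_wordBraid hu, toFraction_wordBraid hv] at hfraction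
    exact mk_eq_mk.1 (toFractionGroup_injective hfraction)
  · rintro ⟨huv, hvu⟩
    have hmul := wordBraid_wordRes_mul hu hv
    rwa [wordBraid_eq_one_of_allOnes n huv, wordBraid_eq_one_of_allOnes n hvu, one_mul,
      one_mul] at hmul

theorem wordBraid_mem_BKL (hu : SupportedWord n u) : wordBraid n u ∈ BKL n := by
  induction u with
  | nil => exact one_mem _
  | cons s u ih =>
    rw [SupportedWord.cons_iff] at hu
    exact mul_mem (ih hu.2) (simpleBraid_mem_BKL hu.1)

theorem exists_wordBraid_eq (hx : x ∈ BKL n) : ∃ u, SupportedWord n u ∧ wordBraid n u = x := by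
  induction hx using Submonoid.closure_induction with
  | mem x hx =>
    obtain ⟨p, q, hp, hpq, hq, rfl⟩ := hx
    exact ⟨[transposition p q], .singleton (supportedUpTo_transposition (by omega) (by omega)),
      (wordBraid_singleton n _).trans (simpleBraid_transposition hp hpq hq)⟩
  | one => exact ⟨[], .nil n, rfl⟩
  | mul x y _ _ hx hy =>
    obtain ⟨u, hu, rfl⟩ := hx
    obtain ⟨v, hv, rfl⟩ := hy
    exact ⟨v ++ u, SupportedWord.append_iff.2 ⟨hv, hu⟩, wordBraid_append n v u⟩

theorem rightDvd_wordBraid_iff (hu : SupportedWord n u) (hv : SupportedWord n v) :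
    RightDvd n (wordBraid n u) (wordBraid n v) ↔ WordDvd u v := by
  constructor
  · rintro ⟨z, hz, h⟩
    obtain ⟨w, hw, rfl⟩ := exists_wordBraid_eq hz
    rw [← wordBraid_append, wordBraid_eq_iff hv (SupportedWord.append_iff.2 ⟨hu, hw⟩)] at h
    exact (wordDvd_append u w).trans h.2
  · intro h
    have hres := hu.wordRes hv
    refine ⟨wordBraid n (wordRes u v), wordBraid_mem_BKL hres, ?_⟩
    rw [← wordBraid_append]
    exact (wordBraid_eq_iff hv (SupportedWord.append_iff.2 ⟨hu, hres⟩)).2 h.equiv_append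

end WordBraid

/-! ### The embedding of `BKLₙ₋₁`, the Garside element, and the length -/

section Incl

variable {n i p q : ℕ} {x y : B (n - 1)} {s : NC} {u : List NC}

theorem incl_σ (hi : 1 ≤ i) (hin : i < n - 1) : incl n (σ (n - 1) i) = σ n i := by
  rw [σ_eq_of ⟨hi, hin⟩, σ_eq_of ⟨hi, by omega⟩]
  exact PresentedGroup.toGroup.of (incl_rels n)

theorem incl_sigmaProd (hp : 1 ≤ p) (hq : q ≤ n - 1) :
    incl n (sigmaProd (n - 1) p q) = sigmaProd n p q := by
  rw [sigmaProd, sigmaProd, map_list_prod, List.map_map]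
  refine congrArg List.prod (List.map_congr_left fun i hi => ?_)
  rw [List.Ico.mem] at hi
  exact incl_σ (by omega) (by omega)

theorem incl_a (hp : 1 ≤ p) (hpq : p < q) (hq : q ≤ n - 1) :
    incl n (a (n - 1) p q) = a n p q := by
  rw [a, map_mul, map_mul, map_inv, incl_sigmaProd hp (by omega), incl_σ (by omega) (by omega), a]

theorem incl_simpleBraid (hs : SupportedUpTo (n - 1) s.perm) :
    incl n (simpleBraid (n - 1) s) = simpleBraid n s := by
  induction s, hs using NC.transposition_induction with
  | one => rw [simpleBraid_one, simpleBraid_one, map_one]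
  | mul_transposition s hs p q hp hpq hq hle ih =>
    rw [← simpleBraid_div_transposition_mul hs hp hpq hq hle, map_mul, ih, incl_a hp hpq hq,
      simpleBraid_div_transposition_mul (hs.mono (Nat.sub_le n 1)) hp hpq (by omega) hle]

theorem incl_wordBraid (hu : SupportedWord (n - 1) u) :
    incl n (wordBraid (n - 1) u) = wordBraid n u := by
  induction u with
  | nil => exact map_one _
  | cons s u ih =>
    rw [SupportedWord.cons_iff] at hu
    rw [wordBraid, map_mul, ih hu.2, incl_simpleBraid hu.1, wordBraid]

theorem incl_mem_BKL (hx : x ∈ BKL (n - 1)) : incl n x ∈ BKL n := by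
  obtain ⟨u, hu, rfl⟩ := exists_wordBraid_eq hx
  rw [incl_wordBraid hu]
  exact wordBraid_mem_BKL (hu.mono (Nat.sub_le n 1))

theorem incl_injOn_BKL (n : ℕ) : Set.InjOn (incl n) (BKL (n - 1)) := by
  intro x hx y hy h
  obtain ⟨u, hu, rfl⟩ := exists_wordBraid_eq hx
  obtain ⟨v, hv, rfl⟩ := exists_wordBraid_eq hy
  rw [incl_wordBraid hu, incl_wordBraid hv, wordBraid_eq_iff (hu.mono (Nat.sub_le n 1))
    (hv.mono (Nat.sub_le n 1))] at h
  exact (wordBraid_eq_iff hu hv).2 h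

end Incl

section Garside

variable {n p q : ℕ} {x : B n} {s : NC} {u : List NC}

theorem cyc_of_lt (hp : 1 ≤ p) (hpn : p < n) : cyc n p = p + 1 := by
  rw [cyc_apply]
  grind

theorem cyc_self (hn : 1 ≤ n) : cyc n n = 1 := by
  rw [cyc_apply]
  grind

theorem Δ_eq_simpleBraid (n : ℕ) : Δ n = simpleBraid n (cycle n) := by
  rcases Nat.eq_zero_or_pos n with rfl | hn
  · rfl
  · have hlast : arcProd n (cyc n) n (n + 1) = 1 := by
      rw [← arc_mul_arcProd n (cyc n) (Nat.lt_succ_self n), cyc_self hn, arc_of_le n hn, one_mul]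
      simp [arcProd]
    rw [simpleBraid, perm_cycle, ← arcProd_mul_arcProd n (cyc n) hn (Nat.le_succ n), hlast,
      mul_one, Δ, arcProd]
    refine congrArg List.prod (List.map_congr_left fun i hi => ?_)
    rw [List.Ico.mem] at hi
    rw [cyc_of_lt hi.1 hi.2, arc_of_lt n (Nat.lt_succ_self i)]

-- Dividing `Δ` twice, first by `s` and then by the quotient, yields the rotated `s`.
theorem Δ_mul_simpleBraid (hs : SupportedUpTo n s.perm) :
    Δ n * simpleBraid n s = simpleBraid n (rotate n s) * Δ n := by
  have hcycle : SupportedUpTo n (cycle n).perm := by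
    rw [perm_cycle]
    exact supportedUpTo_cyc n
  have hdiv := supportedUpTo_div (le_cycle hs) hcycle
  have hrotate : div (cycle n) (div (cycle n) s (le_cycle hs)) (le_cycle hdiv) = rotate n s := by
    ext1
    simp only [perm_rotate hs, perm_div, perm_cycle, mul_inv_rev, inv_inv, mul_assoc]
  have hmul := simpleBraid_div_mul hdiv hcycle (le_cycle hdiv)
  rw [hrotate] at hmul
  rw [Δ_eq_simpleBraid]
  nth_rw 1 [← hmul]
  rw [mul_assoc, simpleBraid_div_mul hs hcycle (le_cycle hs)]

theorem φ_apply (n : ℕ) (x : B n) : φ n x = Δ n * x * (Δ n)⁻¹ := rfl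

theorem φ_simpleBraid (hs : SupportedUpTo n s.perm) :
    φ n (simpleBraid n s) = simpleBraid n (rotate n s) := by
  rw [φ_apply, Δ_mul_simpleBraid hs, mul_inv_cancel_right]

theorem φ_wordBraid (hu : SupportedWord n u) :
    φ n (wordBraid n u) = wordBraid n (u.map (rotate n)) := by
  induction u with
  | nil => exact map_one _
  | cons s u ih =>
    rw [SupportedWord.cons_iff] at hu
    rw [wordBraid, map_mul, ih hu.2, φ_simpleBraid hu.1, List.map_cons, wordBraid]

theorem transposition_comm (p q : ℕ) : transposition p q = transposition q p := by
  by_cases h : 1 ≤ p ∧ 1 ≤ q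
  · ext1
    rw [perm_transposition h.1 h.2, perm_transposition h.2 h.1, swap_comm]
  · rw [transposition, transposition, dif_neg h, dif_neg (mt And.symm h)]

theorem rotate_transposition (hp : 1 ≤ p ∧ p ≤ n) (hq : 1 ≤ q ∧ q ≤ n) :
    rotate n (transposition p q) = transposition (cyc n p) (cyc n q) := by
  ext1
  rw [perm_rotate (supportedUpTo_transposition hp hq), perm_transposition hp.1 hq.1,
    perm_transposition ((supportedUpTo_cyc n).apply_mem hp).1
      ((supportedUpTo_cyc n).apply_mem hq).1, swap_apply_apply]

theorem φ_a_of_lt (hp : 1 ≤ p) (hpq : p < q) (hq : q < n) :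
    φ n (a n p q) = a n (p + 1) (q + 1) := by
  rw [← simpleBraid_transposition hp hpq hq.le,
    φ_simpleBraid (supportedUpTo_transposition (by omega) (by omega)),
    rotate_transposition (by omega) (by omega), cyc_of_lt hp (by omega),
    cyc_of_lt (by omega) hq, simpleBraid_transposition (by omega) (by omega) hq]

theorem φ_a_last (hp : 1 ≤ p) (hpn : p < n) : φ n (a n p n) = a n 1 (p + 1) := by
  rw [← simpleBraid_transposition hp hpn le_rfl,
    φ_simpleBraid (supportedUpTo_transposition (by omega) (by omega)),
    rotate_transposition (by omega) (by omega), cyc_of_lt hp hpn, cyc_self (by omega),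
    transposition_comm, simpleBraid_transposition le_rfl (by omega) hpn]

theorem φ_mem_BKL (hx : x ∈ BKL n) : φ n x ∈ BKL n := by
  obtain ⟨u, hu, rfl⟩ := exists_wordBraid_eq hx
  rw [φ_wordBraid hu]
  exact wordBraid_mem_BKL hu.map_rotate

theorem exists_φ_a_eq (hp : 1 ≤ p) (hpq : p < q) (hq : q ≤ n) :
    ∃ p' q', 1 ≤ p' ∧ p' < q' ∧ q' ≤ n ∧ φ n (a n p' q') = a n p q := by
  obtain ⟨q, rfl⟩ := Nat.exists_eq_add_of_le' (hp.trans hpq.le)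
  rcases hp.eq_or_lt with rfl | hp
  · exact ⟨q, n, by omega, hq, le_rfl, φ_a_last (by omega) hq⟩
  · obtain ⟨p, rfl⟩ := Nat.exists_eq_add_of_le' hp.le
    exact ⟨p, q, by omega, by omega, by omega, φ_a_of_lt (by omega) (by omega) hq⟩

theorem exists_mem_BKL_φ_eq (hx : x ∈ BKL n) : ∃ y ∈ BKL n, φ n y = x := by
  induction hx using Submonoid.closure_induction with
  | mem x hx =>
    obtain ⟨p, q, hp, hpq, hq, rfl⟩ := hx
    obtain ⟨p', q', hp', hpq', hq', hφ⟩ := exists_φ_a_eq hp hpq hq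
    exact ⟨a n p' q', a_mem_BKL hp' hpq' hq', hφ⟩
  | one => exact ⟨1, one_mem _, map_one _⟩
  | mul x y _ _ hx hy =>
    obtain ⟨x', hx', rfl⟩ := hx
    obtain ⟨y', hy', rfl⟩ := hy
    exact ⟨x' * y', mul_mem hx' hy', map_mul _ _ _⟩

theorem φ_pow_succ_apply (n k : ℕ) (x : B n) : (φ n ^ (k + 1)) x = φ n ((φ n ^ k) x) := by
  rw [pow_succ', MulAut.mul_apply]

theorem φ_pow_mem_BKL (k : ℕ) (hx : x ∈ BKL n) : (φ n ^ k) x ∈ BKL n := by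
  induction k with
  | zero => exact hx
  | succ k ih =>
    rw [φ_pow_succ_apply]
    exact φ_mem_BKL ih

theorem exists_mem_BKL_φ_pow_eq (k : ℕ) (hx : x ∈ BKL n) : ∃ y ∈ BKL n, (φ n ^ k) y = x := by
  induction k generalizing x with
  | zero => exact ⟨x, hx, rfl⟩
  | succ k ih =>
    obtain ⟨z, hz, rfl⟩ := exists_mem_BKL_φ_eq hx
    obtain ⟨y, hy, rfl⟩ := ih hz
    exact ⟨y, hy, φ_pow_succ_apply n k y⟩

-- A generator that involves the last strand leaves it after one rotation backwards, or after two
-- if it also involves the first one.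
theorem exists_φ_pow_a_eq (hn : 3 ≤ n) (hp : 1 ≤ p) (hpq : p < q) (hq : q ≤ n) :
    ∃ k p' q', 1 ≤ p' ∧ p' < q' ∧ q' < n ∧ (φ n ^ k) (a n p' q') = a n p q := by
  obtain ⟨q, rfl⟩ := Nat.exists_eq_add_of_le' (hp.trans hpq.le)
  rcases hq.lt_or_eq with hq | rfl
  · exact ⟨0, p, q + 1, hp, hpq, hq, rfl⟩
  rcases hp.eq_or_lt with rfl | hp
  · obtain ⟨r, rfl⟩ := Nat.exists_eq_add_of_le' (by omega : 1 ≤ q)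
    refine ⟨2, r, r + 1, by omega, by omega, by omega, ?_⟩
    rw [φ_pow_succ_apply, pow_one, φ_a_of_lt (by omega) (by omega) (by omega),
      φ_a_last (by omega) (by omega)]
  · obtain ⟨p, rfl⟩ := Nat.exists_eq_add_of_le' hp.le
    exact ⟨1, p, q, by omega, by omega, by omega, φ_a_of_lt (by omega) (by omega) hq⟩

end Garside

section Length

variable {n p q : ℕ} {x y : B n}

theorem len_rels (n : ℕ) : ∀ r ∈ artinRels n,
    FreeGroup.lift (fun _ : Idx n => Multiplicative.ofAdd (1 : ℤ)) r = 1 := by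
  rintro r (⟨i, j, -, rfl⟩ | ⟨i, j, -, rfl⟩) <;>
    simp only [map_mul, map_inv, FreeGroup.lift_apply_of, mul_inv_cancel]

/-- The length of a braid, that is, the exponent sum of the words that represent it in the Artin
generators. -/
def len (n : ℕ) (x : B n) : ℤ := (PresentedGroup.toGroup (len_rels n) x).toAdd

theorem len_one (n : ℕ) : len n 1 = 0 := by
  rw [len, map_one, toAdd_one]

theorem len_mul (x y : B n) : len n (x * y) = len n x + len n y := by
  rw [len, map_mul, toAdd_mul, len, len]

theorem len_pow (x : B n) (k : ℕ) : len n (x ^ k) = k * len n x := by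
  rw [len, map_pow, toAdd_pow, nsmul_eq_mul, len]

theorem len_conj (x y : B n) : len n (x * y * x⁻¹) = len n y := by
  rw [len_mul, len_mul, add_right_comm, ← len_mul, mul_inv_cancel, len_one, zero_add]

theorem len_φ (x : B n) : len n (φ n x) = len n x := len_conj _ _

theorem len_φ_pow (k : ℕ) (x : B n) : len n ((φ n ^ k) x) = len n x := by
  induction k with
  | zero => rfl
  | succ k ih => rw [φ_pow_succ_apply, len_φ, ih]

theorem len_a (hp : 1 ≤ p) (hpq : p < q) (hq : q ≤ n) : len n (a n p q) = 1 := by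
  rw [a, len_conj, σ_eq_of (by omega), len, PresentedGroup.toGroup.of (len_rels n), toAdd_ofAdd]

theorem len_nonneg (hx : x ∈ BKL n) : 0 ≤ len n x := by
  induction hx using Submonoid.closure_induction with
  | mem x hx =>
    obtain ⟨p, q, hp, hpq, hq, rfl⟩ := hx
    rw [len_a hp hpq hq]
    exact zero_le_one
  | one => rw [len_one]
  | mul x y _ _ hx hy =>
    rw [len_mul]
    exact add_nonneg hx hy

theorem eq_one_or_exists_eq_mul_a (hx : x ∈ BKL n) :
    x = 1 ∨ ∃ z ∈ BKL n, ∃ p q, 1 ≤ p ∧ p < q ∧ q ≤ n ∧ x = z * a n p q := by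
  induction hx using Submonoid.closure_induction with
  | mem x hx =>
    obtain ⟨p, q, hp, hpq, hq, rfl⟩ := hx
    exact Or.inr ⟨1, one_mem _, p, q, hp, hpq, hq, (one_mul _).symm⟩
  | one => exact Or.inl rfl
  | mul x y hx _ ihx ihy =>
    rcases ihy with rfl | ⟨z, hz, p, q, hp, hpq, hq, rfl⟩
    · rwa [mul_one]
    · exact Or.inr ⟨x * z, mul_mem hx hz, p, q, hp, hpq, hq, (mul_assoc _ _ _).symm⟩

theorem eq_one_of_len_le_zero (hx : x ∈ BKL n) (h : len n x ≤ 0) : x = 1 := by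
  rcases eq_one_or_exists_eq_mul_a hx with hx | ⟨z, hz, p, q, hp, hpq, hq, rfl⟩
  · exact hx
  · rw [len_mul, len_a hp hpq hq] at h
    have := len_nonneg hz
    omega

theorem len_incl {x : B (n - 1)} (hx : x ∈ BKL (n - 1)) : len n (incl n x) = len (n - 1) x := by
  induction hx using Submonoid.closure_induction with
  | mem x hx =>
    obtain ⟨p, q, hp, hpq, hq, rfl⟩ := hx
    rw [incl_a hp hpq hq, len_a hp hpq (by omega), len_a hp hpq hq]
  | one => rw [map_one, len_one, len_one]
  | mul x y _ _ hx hy => rw [map_mul, len_mul, len_mul, hx, hy]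

end Length

/-! ### Tails and splittings -/

namespace RightDvd

variable {n : ℕ} {x y z : B n}

theorem refl (x : B n) : RightDvd n x x := ⟨1, one_mem _, (one_mul x).symm⟩

theorem mul_left (hz : z ∈ BKL n) (x : B n) : RightDvd n x (z * x) := ⟨z, hz, rfl⟩

theorem one_left (hx : x ∈ BKL n) : RightDvd n 1 x := ⟨x, hx, (mul_one x).symm⟩

theorem trans (hxy : RightDvd n x y) (hyz : RightDvd n y z) : RightDvd n x z := by
  obtain ⟨u, hu, rfl⟩ := hxy
  obtain ⟨v, hv, rfl⟩ := hyz
  exact ⟨v * u, mul_mem hv hu, (mul_assoc _ _ _).symm⟩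

theorem len_le (h : RightDvd n x y) : len n x ≤ len n y := by
  obtain ⟨u, hu, rfl⟩ := h
  rw [len_mul]
  exact le_add_of_nonneg_left (len_nonneg hu)

theorem eq_of_len_le (h : RightDvd n x y) (hlen : len n y ≤ len n x) : x = y := by
  obtain ⟨u, hu, rfl⟩ := h
  rw [len_mul, add_le_iff_nonpos_left] at hlen
  rw [eq_one_of_len_le_zero hu hlen, one_mul]

theorem antisymm (hxy : RightDvd n x y) (hyx : RightDvd n y x) : x = y :=
  hxy.eq_of_len_le hyx.len_le

theorem map_incl {x y : B (n - 1)} (h : RightDvd (n - 1) x y) :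
    RightDvd n (incl n x) (incl n y) := by
  obtain ⟨u, hu, rfl⟩ := h
  exact ⟨incl n u, incl_mem_BKL hu, map_mul _ _ _⟩

end RightDvd

section Tail

variable {n p q : ℕ} {x : B n} {t t' : B (n - 1)} {s : NC} {u : List NC}

-- The lcm in `BKLₙ₋₁` is still an lcm in `BKLₙ`: the residues that compute it do not depend on
-- the number of strands.
theorem exists_lcm_incl (ht : t ∈ BKL (n - 1)) (ht' : t' ∈ BKL (n - 1)) :
    ∃ z ∈ BKL (n - 1), RightDvd (n - 1) t z ∧ RightDvd (n - 1) t' z ∧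
      ∀ x ∈ BKL n, RightDvd n (incl n t) x → RightDvd n (incl n t') x →
        RightDvd n (incl n z) x := by
  obtain ⟨u, hu, rfl⟩ := exists_wordBraid_eq ht
  obtain ⟨v, hv, rfl⟩ := exists_wordBraid_eq ht'
  have hlcm : SupportedWord (n - 1) (u ++ wordRes u v) :=
    SupportedWord.append_iff.2 ⟨hu, hu.wordRes hv⟩
  have hn := Nat.sub_le n 1
  refine ⟨wordBraid (n - 1) (u ++ wordRes u v), wordBraid_mem_BKL hlcm,
    (rightDvd_wordBraid_iff hu hlcm).2 (wordDvd_append _ _),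
    (rightDvd_wordBraid_iff hv hlcm).2 (wordDvd_append_wordRes _ _), fun x hx hux hvx => ?_⟩
  obtain ⟨w, hw, rfl⟩ := exists_wordBraid_eq hx
  rw [incl_wordBraid hu, rightDvd_wordBraid_iff (hu.mono hn) hw] at hux
  rw [incl_wordBraid hv, rightDvd_wordBraid_iff (hv.mono hn) hw] at hvx
  rw [incl_wordBraid hlcm, rightDvd_wordBraid_iff (hlcm.mono hn) hw]
  exact append_wordRes_wordDvd hux hvx

theorem exists_isTail (hx : x ∈ BKL n) : ∃ t, IsTail n x t := by
  obtain ⟨-, ⟨t, ht, htx, rfl⟩, hmax⟩ := Int.exists_greatest_of_bdd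
    (P := fun l => ∃ t ∈ BKL (n - 1), RightDvd n (incl n t) x ∧ len (n - 1) t = l)
    ⟨len n x, by rintro - ⟨t, ht, htx, rfl⟩; exact (len_incl ht).symm.trans_le htx.len_le⟩
    ⟨_, 1, one_mem _, by rw [map_one]; exact RightDvd.one_left hx, rfl⟩
  refine ⟨t, ht, htx, fun u hu hux => ?_⟩
  obtain ⟨z, hz, htz, huz, hlcm⟩ := exists_lcm_incl ht hu
  rw [htz.eq_of_len_le (hmax _ ⟨z, hz, hlcm x hx htx hux, rfl⟩)]
  exact huz.map_incl

theorem IsTail.unique (h : IsTail n x t) (h' : IsTail n x t') : t = t' :=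
  incl_injOn_BKL n h.1 h'.1 ((h'.2.2 t h.1 h.2.1).antisymm (h.2.2 t' h'.1 h'.2.1))

theorem not_rightDvd_a_one (hp : 1 ≤ p) (hpq : p < q) (hq : q ≤ n) : ¬ RightDvd n (a n p q) 1 := by
  intro h
  have hlen := h.len_le
  rw [len_a hp hpq hq, len_one] at hlen
  omega

theorem isTail_one_iff (hx : x ∈ BKL n) :
    IsTail n x 1 ↔ ∀ p q, 1 ≤ p → p < q → q < n → ¬ RightDvd n (a n p q) x := by
  constructor
  · intro h p q hp hpq hq hdvd
    have hmax := h.2.2 (a (n - 1) p q) (a_mem_BKL hp hpq (by omega))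
    rw [incl_a hp hpq (by omega), map_one] at hmax
    exact not_rightDvd_a_one hp hpq hq.le (hmax hdvd)
  · intro h
    refine ⟨one_mem _, by rw [map_one]; exact RightDvd.one_left hx, fun u hu hux => ?_⟩
    rcases eq_one_or_exists_eq_mul_a hu with rfl | ⟨z, hz, p, q, hp, hpq, hq, rfl⟩
    · exact RightDvd.refl _
    · rw [map_mul, incl_a hp hpq hq] at hux
      exact absurd ((RightDvd.mul_left (incl_mem_BKL hz) _).trans hux) (h p q hp hpq (by omega))

theorem isTail_one_one (n : ℕ) : IsTail n 1 1 :=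
  (isTail_one_iff (one_mem _)).2 fun _ _ hp hpq hq => not_rightDvd_a_one hp hpq hq.le

theorem IsTail.mul_incl (h : IsTail n x 1) (hx : x ∈ BKL n) (ht : t ∈ BKL (n - 1)) :
    IsTail n (x * incl n t) t := by
  refine ⟨ht, RightDvd.mul_left hx _, fun u hu hux => ?_⟩
  obtain ⟨-, -, ⟨y, hy, rfl⟩, huz, hlcm⟩ := exists_lcm_incl ht hu
  obtain ⟨w, hw, hxw⟩ :=
    hlcm _ (mul_mem hx (incl_mem_BKL ht)) (RightDvd.mul_left hx _) hux
  rw [map_mul, ← mul_assoc] at hxw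
  have hyx : RightDvd n (incl n y) x := ⟨w, hw, mul_right_cancel hxw⟩
  have hy1 : incl n y = 1 :=
    ((h.2.2 y hy hyx).trans (by rw [map_one]; exact RightDvd.refl 1)).antisymm
      (RightDvd.one_left (incl_mem_BKL hy))
  simpa only [map_mul, hy1, one_mul] using huz.map_incl

theorem IsTail.exists_eq_mul (h : IsTail n x t) :
    ∃ y ∈ BKL n, x = y * incl n t ∧ IsTail n y 1 := by
  obtain ⟨ht, ⟨y, hy, rfl⟩, hmax⟩ := h
  refine ⟨y, hy, rfl, one_mem _, by rw [map_one]; exact RightDvd.one_left hy, ?_⟩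
  rintro u hu ⟨w, hw, rfl⟩
  have hlen := (hmax (u * t) (mul_mem hu ht) ⟨w, hw, by rw [map_mul, ← mul_assoc]⟩).len_le
  rw [map_mul, len_mul, add_le_iff_nonpos_left] at hlen
  rw [eq_one_of_len_le_zero (incl_mem_BKL hu) hlen, map_one]
  exact RightDvd.refl 1

theorem rightDvd_a_wordBraid_iff (hp : 1 ≤ p) (hpq : p < q) (hq : q ≤ n)
    (hu : SupportedWord n u) :
    RightDvd n (a n p q) (wordBraid n u) ↔ WordDvd [transposition p q] u := by
  rw [← rightDvd_wordBraid_iff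
    (.singleton (supportedUpTo_transposition (by omega) (by omega))) hu, wordBraid_singleton,
    simpleBraid_transposition hp hpq hq]

theorem supportedUpTo_of_singleton_wordDvd (hu : SupportedWord n u) (h : WordDvd [s] u) :
    SupportedUpTo n s.perm := by
  induction u generalizing s with
  | nil =>
    obtain rfl : s = 1 := h s (List.mem_singleton_self s)
    exact .one n
  | cons t u ih =>
    rw [SupportedWord.cons_iff] at hu
    have hres : SupportedUpTo n (res t s).perm := ih hu.2 h
    have hsup : SupportedUpTo n (t ⊔ s).perm := by
      have hmul := hres.mul hu.1
      rwa [perm_res, inv_mul_cancel_right] at hmul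
    exact hsup.of_refines (le_sup_right : s ≤ t ⊔ s)

theorem not_rightDvd_a_incl (hp : 1 ≤ p) (hpn : p < n) (ht : t ∈ BKL (n - 1)) :
    ¬ RightDvd n (a n p n) (incl n t) := by
  obtain ⟨u, hu, rfl⟩ := exists_wordBraid_eq ht
  rw [incl_wordBraid hu, rightDvd_a_wordBraid_iff hp hpn le_rfl (hu.mono (Nat.sub_le n 1))]
  intro h
  have hfix := supportedUpTo_of_singleton_wordDvd hu h n (by omega)
  rw [perm_transposition hp (by omega), swap_apply_right] at hfix
  omega

end Tail

section Splitting

variable {n : ℕ} {β x : B n} {s s' s₁ s₂ : List (B (n - 1))} {t : B (n - 1)}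

theorem splitProd_concat (n : ℕ) (s : List (B (n - 1))) (t : B (n - 1)) :
    splitProd n (s ++ [t]) = φ n (splitProd n s) * incl n t := by
  induction s with
  | nil => simp [splitProd]
  | cons b s ih =>
    rw [List.cons_append, splitProd, ih, splitProd, map_mul, List.length_append,
      List.length_singleton, φ_pow_succ_apply, mul_assoc]

theorem splitProd_singleton (n : ℕ) (t : B (n - 1)) : splitProd n [t] = incl n t := by
  simp [splitProd]

theorem splitProd_mem_BKL (hs : ∀ b ∈ s, b ∈ BKL (n - 1)) : splitProd n s ∈ BKL n := by
  induction s with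
  | nil => exact one_mem _
  | cons b s ih =>
    rw [List.forall_mem_cons] at hs
    exact mul_mem (φ_pow_mem_BKL _ (incl_mem_BKL hs.1)) (ih hs.2)

theorem splitProd_ne_one (hs : ∀ b ∈ s, b ∈ BKL (n - 1)) (hs₀ : s ≠ [])
    (hhead : s.head? ≠ some 1) : splitProd n s ≠ 1 := by
  cases s with
  | nil => exact absurd rfl hs₀
  | cons b s =>
    rw [List.forall_mem_cons] at hs
    intro hone
    have hlen := congrArg (len n) hone
    rw [splitProd, len_mul, len_φ_pow, len_one, len_incl hs.1] at hlen
    have hnonneg := len_nonneg (splitProd_mem_BKL hs.2)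
    exact hhead (congrArg some (eq_one_of_len_le_zero hs.1 (by omega)))

namespace IsSplitting

theorem ne_nil (h : IsSplitting n β s) : s ≠ [] := h.2.1

theorem forall_mem_BKL (h : IsSplitting n β s) : ∀ b ∈ s, b ∈ BKL (n - 1) := h.2.2.1

theorem head?_ne (h : IsSplitting n β s) (hs : 2 ≤ s.length) : s.head? ≠ some 1 := h.2.2.2.1 hs

theorem eq_splitProd (h : IsSplitting n β s) : β = splitProd n s := h.2.2.2.2.1

theorem isTail_append (h : IsSplitting n β (s₁ ++ s₂)) (hs₂ : s₂ ≠ []) :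
    IsTail n (φ n (splitProd n s₁)) 1 := by
  have htail := h.2.2.2.2.2 s₂.length (List.length_pos_iff.2 hs₂) (by simp)
  rwa [List.length_append, Nat.add_sub_cancel, List.take_left] at htail

theorem of_isTail_append (hs₀ : s ≠ []) (hs : ∀ b ∈ s, b ∈ BKL (n - 1))
    (hhead : 2 ≤ s.length → s.head? ≠ some 1)
    (htail : ∀ s₁ s₂, s = s₁ ++ s₂ → s₂ ≠ [] → IsTail n (φ n (splitProd n s₁)) 1) :
    IsSplitting n (splitProd n s) s := by
  refine ⟨splitProd_mem_BKL hs, hs₀, hs, hhead, rfl, fun k hk hks => ?_⟩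
  refine htail _ (s.drop (s.length - k)) (List.take_append_drop _ _).symm fun hnil => ?_
  rw [List.drop_eq_nil_iff] at hnil
  omega

end IsSplitting

theorem isSplitting_singleton : IsSplitting n β [t] ↔ t ∈ BKL (n - 1) ∧ β = incl n t := by
  constructor
  · intro h
    exact ⟨h.forall_mem_BKL t (by simp), h.eq_splitProd.trans (splitProd_singleton n t)⟩
  · rintro ⟨ht, rfl⟩
    rw [← splitProd_singleton]
    refine .of_isTail_append (by simp) (by simpa using ht) (by simp) fun s₁ s₂ heq hs₂ => ?_
    obtain rfl : s₁ = [] := by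
      have hlen := congrArg List.length heq
      have := List.length_pos_iff.2 hs₂
      rw [List.length_singleton, List.length_append] at hlen
      exact List.length_eq_zero_iff.1 (by omega)
    simpa only [splitProd, map_one] using isTail_one_one n

theorem isSplitting_concat (hs : s ≠ []) :
    IsSplitting n β (s ++ [t]) ↔ IsSplitting n (splitProd n s) s ∧ s.head? ≠ some 1 ∧
      t ∈ BKL (n - 1) ∧ β = φ n (splitProd n s) * incl n t ∧
        IsTail n (φ n (splitProd n s)) 1 := by
  have hhead : (s ++ [t]).head? = s.head? := List.head?_append_of_ne_nil s hs
  have hlen : 2 ≤ (s ++ [t]).length := by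
    have := List.length_pos_iff.2 hs
    rw [List.length_append, List.length_singleton]
    omega
  rw [← splitProd_concat]
  constructor
  · intro h
    have hmem := List.forall_mem_append.1 h.forall_mem_BKL
    have hhead_s : s.head? ≠ some 1 := by simpa only [hhead] using h.head?_ne hlen
    refine ⟨.of_isTail_append hs hmem.1 (fun _ => hhead_s) ?_, hhead_s,
      hmem.2 t (List.mem_singleton_self t), h.eq_splitProd, h.isTail_append (by simp)⟩
    rintro s₁ s₂ rfl -
    rw [List.append_assoc] at h
    exact h.isTail_append (by simp)
  · rintro ⟨h, hhead_s, ht, rfl, htail⟩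
    refine .of_isTail_append (by simp)
      (List.forall_mem_append.2 ⟨h.forall_mem_BKL, by simpa using ht⟩)
      (fun _ => by rwa [hhead]) fun s₁ s₂ heq hs₂ => ?_
    obtain ⟨s₂, b, rfl⟩ := (List.eq_nil_or_concat s₂).resolve_left hs₂
    rw [List.concat_eq_append, ← List.append_assoc] at heq
    obtain ⟨rfl, -⟩ := List.append_inj' heq rfl
    rcases eq_or_ne s₂ [] with rfl | hs₂
    · rwa [List.append_nil] at htail
    · exact h.isTail_append hs₂

namespace IsSplitting

theorem eq_φ_mul_incl (h : IsSplitting n β (s ++ [t])) :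
    β = φ n (splitProd n s) * incl n t := by
  rw [h.eq_splitProd, splitProd_concat]

theorem isTail_last (h : IsSplitting n β (s ++ [t])) : IsTail n β t := by
  have hmem := List.forall_mem_append.1 h.forall_mem_BKL
  rw [h.eq_φ_mul_incl]
  exact (h.isTail_append (by simp)).mul_incl (φ_mem_BKL (splitProd_mem_BKL hmem.1))
    (hmem.2 t (List.mem_singleton_self t))

theorem splitProd_init_eq_one_iff (h : IsSplitting n β (s ++ [t])) :
    splitProd n s = 1 ↔ s = [] := by
  refine ⟨fun hone => ?_, fun hs => by rw [hs, splitProd]⟩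
  by_contra hs
  obtain ⟨hsplit, hhead, -⟩ := (isSplitting_concat hs).1 h
  exact splitProd_ne_one hsplit.forall_mem_BKL hs hhead hone

theorem unique (h : IsSplitting n β s) (h' : IsSplitting n β s') : s = s' := by
  induction s using List.reverseRecOn generalizing β s' with
  | nil => exact absurd rfl h.ne_nil
  | append_singleton s t ih =>
    obtain ⟨s', t', rfl⟩ := (List.eq_nil_or_concat s').resolve_left h'.ne_nil
    rw [List.concat_eq_append] at h' ⊢
    obtain rfl := h.isTail_last.unique h'.isTail_last
    have hprod : splitProd n s = splitProd n s' :=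
      (φ n).injective (mul_right_cancel (h.eq_φ_mul_incl.symm.trans h'.eq_φ_mul_incl))
    have hnil : s = [] ↔ s' = [] := by
      rw [← h.splitProd_init_eq_one_iff, ← h'.splitProd_init_eq_one_iff, hprod]
    by_cases hs : s = []
    · rw [hs, hnil.1 hs]
    · have hsplit' := ((isSplitting_concat (mt hnil.2 hs)).1 h').1
      rw [← hprod] at hsplit'
      rw [ih ((isSplitting_concat hs).1 h).1 hsplit']

end IsSplitting

theorem exists_isSplitting_φ_mul_incl (ht : t ∈ BKL (n - 1))
    (hx : x ≠ 1 → ∃ s, IsSplitting n x s) (htail : IsTail n (φ n x) 1) :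
    ∃ s, IsSplitting n (φ n x * incl n t) s := by
  rcases eq_or_ne x 1 with rfl | hx1
  · exact ⟨[t], isSplitting_singleton.2 ⟨ht, by rw [map_one, one_mul]⟩⟩
  obtain ⟨s, hs⟩ := hx hx1
  obtain rfl := hs.eq_splitProd
  refine ⟨s ++ [t], (isSplitting_concat hs.ne_nil).2 ⟨hs, fun hhead => ?_, ht, rfl, htail⟩⟩
  rcases s with _ | ⟨b, _ | ⟨c, s⟩⟩
  · exact hs.ne_nil rfl
  · rw [splitProd_singleton] at hx1
    rw [List.head?_cons, Option.some_inj] at hhead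
    exact hx1 (by rw [hhead, map_one])
  · exact hs.head?_ne (by simp) hhead

theorem exists_eq_φ_mul_incl (hx : x ∈ BKL n) :
    ∃ y ∈ BKL n, ∃ t ∈ BKL (n - 1), x = φ n y * incl n t ∧ IsTail n (φ n y) 1 ∧
      len n x = len n y + len (n - 1) t := by
  obtain ⟨t, ht⟩ := exists_isTail hx
  obtain ⟨z, hz, rfl, htail⟩ := ht.exists_eq_mul
  obtain ⟨y, hy, rfl⟩ := exists_mem_BKL_φ_eq hz
  exact ⟨y, hy, t, ht.1, rfl, htail, by rw [len_mul, len_φ, len_incl ht.1]⟩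

theorem exists_isSplitting_φ_pow (k : ℕ) (hx : x ∈ BKL n) {p q : ℕ} (hp : 1 ≤ p) (hpq : p < q)
    (hq : q < n) (hdvd : RightDvd n (a n p q) x)
    (ih : ∀ y ∈ BKL n, len n y < len n x → ∃ s, IsSplitting n y s) :
    ∃ s, IsSplitting n ((φ n ^ k) x) s := by
  obtain ⟨y, hy, t, ht, heq, htail, hlen⟩ := exists_eq_φ_mul_incl (φ_pow_mem_BKL k hx)
  rw [len_φ_pow] at hlen
  rw [heq]
  refine exists_isSplitting_φ_mul_incl ht (fun _ => ?_) htail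
  rcases lt_or_ge 0 (len (n - 1) t) with ht0 | ht0
  · exact ih y hy (by omega)
  rw [eq_one_of_len_le_zero ht ht0, map_one, mul_one] at heq
  cases k with
  | zero =>
    rw [← heq] at htail
    exact absurd hdvd ((isTail_one_iff hx).1 htail p q hp hpq hq)
  | succ k =>
    rw [φ_pow_succ_apply] at heq
    rw [← (φ n).injective heq]
    exact exists_isSplitting_φ_pow k hx hp hpq hq hdvd ih

-- Splitting off a trivial tail does not shorten the braid but only undoes one rotation. Rotating
-- the last generator back into `BKLₙ₋₁` therefore bounds the number of steps until the tail is
-- nontrivial.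
theorem exists_isSplitting (hn : 3 ≤ n) (hx : x ∈ BKL n) : ∃ s, IsSplitting n x s := by
  induction hl : (len n x).toNat using Nat.strong_induction_on generalizing x with
  | _ l ih =>
    rcases eq_one_or_exists_eq_mul_a hx with rfl | ⟨z, hz, p, q, hp, hpq, hq, rfl⟩
    · exact ⟨[1], isSplitting_singleton.2 ⟨one_mem _, (map_one _).symm⟩⟩
    obtain ⟨k, p', q', hp', hpq', hq', ha⟩ := exists_φ_pow_a_eq hn hp hpq hq
    obtain ⟨y, hy, rfl⟩ := exists_mem_BKL_φ_pow_eq k hz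
    rw [← ha, ← map_mul] at hl ⊢
    rw [len_φ_pow] at hl
    refine exists_isSplitting_φ_pow k (mul_mem hy (a_mem_BKL hp' hpq' hq'.le)) hp' hpq' hq'
      (RightDvd.mul_left hy _) fun w hw hlt => ih _ ?_ hw rfl
    have hnonneg := len_nonneg hw
    omega

end Splitting

/-! ### The rotating ordering -/

section Order

theorem exists_eq_a_pow {x : B 2} (hx : x ∈ BKL 2) : ∃ i : ℕ, x = a 2 1 2 ^ i := by
  induction hx using Submonoid.closure_induction with
  | mem x hx =>
    obtain ⟨p, q, hp, hpq, hq, rfl⟩ := hx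
    obtain rfl : p = 1 := by omega
    obtain rfl : q = 2 := by omega
    exact ⟨1, (pow_one _).symm⟩
  | one => exact ⟨0, rfl⟩
  | mul x y _ _ hx hy =>
    obtain ⟨i, rfl⟩ := hx
    obtain ⟨j, rfl⟩ := hy
    exact ⟨i + j, (pow_add _ _ _).symm⟩

theorem len_a_pow (i : ℕ) : len 2 (a 2 1 2 ^ i) = i := by
  rw [len_pow, len_a le_rfl one_lt_two le_rfl, mul_one]

theorem RotLT.asymm {m : ℕ} {x y : B (m + 2)} (h : RotLT (m + 2) x y) :
    ¬ RotLT (m + 2) y x := by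
  induction m with
  | zero =>
    obtain ⟨i, j, hij, rfl, rfl⟩ := h
    rintro ⟨k, l, hkl, hjk, hil⟩
    replace hjk := congrArg (len 2) hjk
    replace hil := congrArg (len 2) hil
    rw [len_a_pow, len_a_pow] at hjk hil
    omega
  | succ m ih =>
    obtain ⟨s, t, hs, ht, hst⟩ := h
    rintro ⟨t', s', ht', hs', hts⟩
    obtain rfl := hs.unique hs'
    obtain rfl := ht.unique ht'
    have : Std.Asymm (RotLT (m + 2)) := ⟨fun _ _ => ih⟩
    exact asymm_of (List.Shortlex (RotLT (m + 2))) hst hts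

theorem RotLT.not_rotLE {m : ℕ} {x y : B (m + 2)} (h : RotLT (m + 2) x y) :
    ¬ RotLE (m + 2) y x := by
  rintro (h' | rfl)
  · exact h.asymm h'
  · exact h.asymm h

variable {m : ℕ} {x y : B (m + 3)} {s t : List (B (m + 2))}

theorem eq_or_lex_of_forall₂_rotLE {k : ℕ} {s t : List (B k)}
    (h : List.Forall₂ (RotLE k) s t) : s = t ∨ List.Lex (RotLT k) s t := by
  induction h with
  | nil => exact Or.inl rfl
  | cons h _ ih =>
    rcases h with h | rfl
    · exact Or.inr (List.Lex.rel h)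
    · exact ih.imp (congrArg _) List.Lex.cons

theorem IsSplitting.rotLT_of_length_lt (hs : IsSplitting (m + 3) x s)
    (ht : IsSplitting (m + 3) y t) (h : s.length < t.length) : RotLT (m + 3) x y :=
  ⟨s, t, hs, ht, List.Shortlex.of_length_lt h⟩

theorem IsSplitting.rotLE_of_forall₂ (hs : IsSplitting (m + 3) x s)
    (ht : IsSplitting (m + 3) y t) (h : List.Forall₂ (RotLE (m + 2)) s t) :
    RotLE (m + 3) x y := by
  rcases eq_or_lex_of_forall₂_rotLE h with rfl | hlex
  · exact Or.inr (hs.eq_splitProd.trans ht.eq_splitProd.symm)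
  · exact Or.inl ⟨s, t, hs, ht, List.Shortlex.of_lex h.length_eq hlex⟩

theorem HasBreadth.rotLT_of_lt {q r : ℕ} (hx : HasBreadth (m + 3) x q)
    (hy : HasBreadth (m + 3) y r) (h : q < r) : RotLT (m + 3) x y := by
  obtain ⟨s, hs, rfl⟩ := hx
  obtain ⟨t, ht, rfl⟩ := hy
  exact hs.rotLT_of_length_lt ht h

-- The last entry of a splitting is unconstrained, so it can be increased.
theorem HasBreadth.exists_rotLT_of_forall {r : ℕ} (hx : HasBreadth (m + 3) x r)
    (h : ∀ b ∈ BKL (m + 2), ∃ c ∈ BKL (m + 2), RotLT (m + 2) b c) :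
    ∃ y, HasBreadth (m + 3) y r ∧ RotLT (m + 3) x y := by
  obtain ⟨s, hs, rfl⟩ : ∃ s : List (B (m + 2)), IsSplitting (m + 3) x s ∧ s.length = r := hx
  obtain ⟨s, b, rfl⟩ := (List.eq_nil_or_concat s).resolve_left hs.ne_nil
  rw [List.concat_eq_append] at hs ⊢
  obtain ⟨c, hc, hbc⟩ := h b (hs.forall_mem_BKL b (by simp))
  have hsplit : IsSplitting (m + 3) (splitProd (m + 3) (s ++ [c])) (s ++ [c]) := by
    rcases eq_or_ne s [] with rfl | hs₀
    · exact isSplitting_singleton.2 ⟨hc, splitProd_singleton _ _⟩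
    · obtain ⟨hs, hhead, -, -, htail⟩ := (isSplitting_concat hs₀).1 hs
      exact (isSplitting_concat hs₀).2 ⟨hs, hhead, hc, splitProd_concat _ _ _, htail⟩
  have hlex : List.Shortlex (RotLT (m + 2)) [b] [c] := .of_lex rfl (.rel hbc)
  exact ⟨_, ⟨_, hsplit, by simp⟩, _, _, hs, hsplit, hlex.append_left s⟩

theorem exists_hasBreadth {n : ℕ} {x : B n} (hn : 3 ≤ n) (hx : x ∈ BKL n) :
    ∃ r, HasBreadth n x r := by
  obtain ⟨s, hs⟩ := exists_isSplitting hn hx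
  exact ⟨_, s, hs, rfl⟩

theorem exists_rotLT (m : ℕ) : ∀ x ∈ BKL (m + 2), ∃ y ∈ BKL (m + 2), RotLT (m + 2) x y := by
  induction m with
  | zero =>
    intro x hx
    obtain ⟨i, rfl⟩ := exists_eq_a_pow hx
    exact ⟨a 2 1 2 ^ (i + 1), pow_mem (a_mem_BKL le_rfl one_lt_two le_rfl) _,
      i, i + 1, Nat.lt_succ_self i, rfl, rfl⟩
  | succ m ih =>
    intro x hx
    obtain ⟨r, hr⟩ := exists_hasBreadth (n := m + 3) (by omega) hx
    obtain ⟨y, ⟨s, hs, -⟩, hlt⟩ := hr.exists_rotLT_of_forall ih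
    exact ⟨y, hs.1, hlt⟩

theorem HasBreadth.exists_rotLT {r : ℕ} (hx : HasBreadth (m + 3) x r) :
    ∃ y, HasBreadth (m + 3) y r ∧ RotLT (m + 3) x y :=
  hx.exists_rotLT_of_forall (DualBraid.exists_rotLT m)

theorem one_rotLE {x : B (m + 2)} (hx : x ∈ BKL (m + 2)) : RotLE (m + 2) 1 x := by
  induction m with
  | zero =>
    obtain ⟨i, rfl⟩ := exists_eq_a_pow hx
    rcases Nat.eq_zero_or_pos i with rfl | hi
    · exact Or.inr (pow_zero _).symm
    · exact Or.inl ⟨0, i, hi, (pow_zero _).symm, rfl⟩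
  | succ m ih =>
    obtain ⟨s, hs⟩ := exists_isSplitting (n := m + 3) (by omega) hx
    have hone : IsSplitting (m + 3) 1 [1] :=
      isSplitting_singleton.2 ⟨one_mem _, (map_one _).symm⟩
    rcases s with _ | ⟨b, _ | ⟨c, s⟩⟩
    · exact absurd rfl hs.ne_nil
    · exact hone.rotLE_of_forall₂ hs (.cons (ih (hs.forall_mem_BKL b (by simp))) .nil)
    · exact Or.inl (hone.rotLT_of_length_lt hs (by simp))

end Order

section SplittingEntries

variable {n p : ℕ} {β x y : B n} {s s₁ s₂ : List (B (n - 1))} {b : B (n - 1)}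

theorem RightDvd.map_φ (h : RightDvd n x y) : RightDvd n (φ n x) (φ n y) := by
  obtain ⟨u, hu, rfl⟩ := h
  exact ⟨φ n u, φ_mem_BKL hu, map_mul _ _ _⟩

theorem exists_a_mul_φ_incl_eq (hb : b ∈ BKL (n - 1)) :
    ∃ w ∈ BKL n, a n 1 2 * φ n (incl n b) = w * a n 1 2 := by
  induction hb using Submonoid.closure_induction with
  | mem x hx =>
    obtain ⟨p, q, hp, hpq, hq, rfl⟩ := hx
    rw [incl_a hp hpq hq, φ_a_of_lt hp hpq (by omega)]
    rcases eq_or_lt_of_le hp with rfl | hp'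
    · exact ⟨a n 1 (q + 1), a_mem_BKL le_rfl (by omega) (by omega),
        (a_triangle_left n one_lt_two (by omega)).symm⟩
    · exact ⟨a n (p + 1) (q + 1), a_mem_BKL (by omega) (by omega) (by omega),
        (a_commute_a_of_lt n one_lt_two (by omega) (by omega)).eq⟩
  | one => exact ⟨1, one_mem _, by simp⟩
  | mul x y _ _ hx hy =>
    obtain ⟨v, hv, hvx⟩ := hx
    obtain ⟨w, hw, hwy⟩ := hy
    refine ⟨v * w, mul_mem hv hw, ?_⟩
    rw [map_mul, map_mul, ← mul_assoc, hvx, mul_assoc, hwy, mul_assoc]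

theorem rightDvd_φ_mul_incl (hn : 2 ≤ n) (hx : RightDvd n (a n 1 n) x) (hb : b ∈ BKL (n - 1)) :
    RightDvd n (a n 1 2) (φ n (x * incl n b)) := by
  obtain ⟨z, hz, rfl⟩ := hx
  obtain ⟨w, hw, heq⟩ := exists_a_mul_φ_incl_eq hb
  rw [map_mul, map_mul, φ_a_last le_rfl hn, mul_assoc, heq, ← mul_assoc]
  exact .mul_left (mul_mem (φ_mem_BKL hz) hw) _

theorem rightDvd_incl_splitProd_concat (hs : ∀ b ∈ s, b ∈ BKL (n - 1)) (b : B (n - 1)) :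
    RightDvd n (incl n b) (splitProd n (s ++ [b])) := by
  rw [splitProd_concat]
  exact .mul_left (φ_mem_BKL (splitProd_mem_BKL hs)) _

theorem rightDvd_φ_splitProd_concat_one (hs : ∀ b ∈ s, b ∈ BKL (n - 1)) (hp : 1 ≤ p)
    (hpn : p < n - 1) (hb : RightDvd (n - 1) (a (n - 1) p (n - 1)) b) :
    RightDvd n (a n 1 (p + 2)) (φ n (splitProd n (s ++ [b] ++ [1]))) := by
  have hφφ : φ n (φ n (incl n (a (n - 1) p (n - 1)))) = a n 1 (p + 2) := by
    rw [incl_a hp hpn le_rfl, φ_a_of_lt hp hpn (by omega), Nat.sub_add_cancel (by omega),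
      φ_a_last (by omega) (by omega)]
  rw [splitProd_concat _ _ 1, map_one, mul_one, ← hφφ]
  exact (hb.map_incl.trans (rightDvd_incl_splitProd_concat hs b)).map_φ.map_φ

namespace IsSplitting

theorem exists_rightDvd_a_last (h : IsSplitting n β (s₁ ++ b :: s₂)) (hs₂ : s₂ ≠ [])
    (hb : b ≠ 1) : ∃ p, 1 ≤ p ∧ p < n - 1 ∧ RightDvd (n - 1) (a (n - 1) p (n - 1)) b := by
  obtain ⟨hmem₁, hmem⟩ := List.forall_mem_append.1 h.forall_mem_BKL
  have hb_mem := hmem b List.mem_cons_self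
  rw [List.append_cons] at h
  rcases eq_one_or_exists_eq_mul_a hb_mem with rfl | ⟨z, hz, p, q, hp, hpq, hq, rfl⟩
  · exact absurd rfl hb
  rcases eq_or_lt_of_le hq with rfl | hq'
  · exact ⟨p, hp, hpq, .mul_left hz _⟩
  have hdvd : RightDvd n (a n (p + 1) (q + 1))
      (φ n (splitProd n (s₁ ++ [z * a (n - 1) p q]))) := by
    rw [← φ_a_of_lt hp hpq (by omega), ← incl_a hp hpq hq]
    exact ((RightDvd.mul_left hz _).map_incl.trans
      (rightDvd_incl_splitProd_concat hmem₁ _)).map_φ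
  refine absurd hdvd ((isTail_one_iff (φ_mem_BKL (splitProd_mem_BKL ?_))).1
    (h.isTail_append hs₂) _ _ (by omega) (by omega) (by omega))
  exact List.forall_mem_append.2 ⟨hmem₁, by simpa using hb_mem⟩

-- By induction the preceding entry is right-divisible by some `a_{p,n-1}`. Two rotations take this
-- factor to `a_{1,p+2}`, which for `p + 2 < n` lies in `BKLₙ₋₁`; for `p + 2 = n` a third rotation,
-- past the next entry, takes it to `a_{1,2}`. Either way some tail would be nontrivial.
theorem ne_one_of_two_le_length (hn : 3 ≤ n) (h : IsSplitting n β (s₁ ++ b :: s₂))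
    (hs₂ : 2 ≤ s₂.length) : b ≠ 1 := by
  induction s₁ using List.reverseRecOn generalizing b s₂ with
  | nil =>
    rintro rfl
    exact h.head?_ne (by simp only [List.nil_append, List.length_cons]; omega) rfl
  | append_singleton s c ih =>
    rintro rfl
    obtain ⟨b, d, s₂, rfl⟩ : ∃ b d s, s₂ = b :: d :: s := by
      match s₂, hs₂ with
      | b :: d :: s, _ => exact ⟨b, d, s, rfl⟩
    have hc : IsSplitting n β (s ++ c :: 1 :: b :: d :: s₂) := by simpa using h
    obtain ⟨p, hp, hpn, hdvd⟩ := hc.exists_rightDvd_a_last (by simp) (ih hc (by simp))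
    have hmem := List.forall_mem_append.1 hc.forall_mem_BKL
    rw [List.append_cons, List.append_cons] at hc
    have hdvd₁ := rightDvd_φ_splitProd_concat_one hmem.1 hp hpn hdvd
    obtain ⟨hmem₁, hmem₂⟩ := List.forall_mem_append.1 hc.forall_mem_BKL
    have hφ_mem := φ_mem_BKL (splitProd_mem_BKL hmem₁)
    have hb_mem := hmem₂ b List.mem_cons_self
    by_cases hpn' : p + 2 < n
    · exact (isTail_one_iff hφ_mem).1 (hc.isTail_append (by simp)) 1 (p + 2) le_rfl (by omega)
        hpn' hdvd₁
    · rw [show p + 2 = n by omega] at hdvd₁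
      rw [List.append_cons] at hc
      have htail := hc.isTail_append (by simp)
      rw [splitProd_concat _ _ b] at htail
      exact (isTail_one_iff (φ_mem_BKL (mul_mem hφ_mem (incl_mem_BKL hb_mem)))).1 htail 1 2 le_rfl
        one_lt_two (by omega) (rightDvd_φ_mul_incl (by omega) hdvd₁ hb_mem)

end IsSplitting

end SplittingEntries

/-! ### The separators -/

section Swap

variable {p q r k l : ℕ} {s : Perm ℕ}

theorem SameBlock.mem_of_swap (h : SameBlock (swap p q) k l) (hkl : k ≠ l) :
    (k = p ∨ k = q) ∧ (l = p ∨ l = q) := by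
  have hk := h k
  have hl := h l
  rw [swap_apply_def] at hk hl
  unfold InGap at hk hl
  grind

theorem Refines.eq_one_or_eq_swap (h : Refines s (swap p q)) : s = 1 ∨ s = swap p q := by
  have hmoved : ∀ i, s i ≠ i → (i = p ∨ i = q) ∧ (s i = p ∨ s i = q) :=
    fun i hi => (h i).mem_of_swap hi.symm
  by_cases hp : s p = p
  · left
    ext i
    by_contra hi
    rw [Perm.one_apply] at hi
    have hi₁ := hmoved i hi
    have hinj := s.injective.eq_iff (a := i) (b := p)
    grind
  · right
    ext i
    rw [swap_apply_def]
    have hi := hmoved i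
    have hp₁ := hmoved p hp
    have hsp : s (s p) ≠ s p := s.injective.ne hp
    grind

theorem NC.eq_one_or_eq_of_le_transposition {t : NC} (hp : 1 ≤ p) (hq : 1 ≤ q)
    (h : t ≤ transposition p q) : t = 1 ∨ t = transposition p q := by
  rw [le_def, perm_transposition hp hq] at h
  refine h.eq_one_or_eq_swap.imp (fun h => ?_) fun h => ?_ <;> ext1
  · rw [h, perm_one]
  · rw [h, perm_transposition hp hq]

theorem not_noncrossing_swap_mul_swap (hpq : p < q) (hqr : q < r) :
    ¬ Noncrossing (swap q r * swap p q) := by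
  intro h
  have hqp := h q p
  rw [Perm.mul_apply, Perm.mul_apply, swap_apply_left, swap_apply_left, swap_apply_right,
    swap_apply_of_ne_of_ne (by omega) (by omega)] at hqp
  unfold InGap at hqp
  omega

theorem Noncrossing.of_conj_cyc {n : ℕ} (hs : SupportedUpTo n s)
    (h : Noncrossing (cyc n * s * (cyc n)⁻¹)) : Noncrossing s := by
  have hsupp := ((supportedUpTo_cyc n).mul hs).mul (supportedUpTo_cyc n).inv
  have hconj := Refines.inv_conj h h h (cycle n).noncrossing hsupp.refines_cyc
  simp only [perm_cycle, mul_assoc, inv_mul_cancel_left, inv_mul_cancel, mul_one] at hconj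
  exact hconj

end Swap

section SeparatorWord

variable {n r : ℕ}

/-- The simple element of the braid `φₙ^j(a_{n-2,n-1})`. -/
noncomputable def sepLetter (n : ℕ) : ℕ → NC
  | 0 => transposition (n - 2) (n - 1)
  | j + 1 => rotate n (sepLetter n j)

/-- A word for the braid `φₙ^{j+k-1}(a_{n-2,n-1}) ⋯ φₙ^j(a_{n-2,n-1})`, which is the separator
`sep n k` when `j = 2`. -/
noncomputable def sepWord (n j k : ℕ) : List NC := (List.range k).map fun i => sepLetter n (j + i)

theorem exists_sepLetter_eq (hn : 3 ≤ n) (j : ℕ) :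
    ∃ p q, (1 ≤ p ∧ p ≤ n) ∧ (1 ≤ q ∧ q ≤ n) ∧ sepLetter n j = transposition p q := by
  induction j with
  | zero => exact ⟨n - 2, n - 1, by omega, by omega, rfl⟩
  | succ j ih =>
    obtain ⟨p, q, hp, hq, heq⟩ := ih
    exact ⟨cyc n p, cyc n q, (supportedUpTo_cyc n).apply_mem hp,
      (supportedUpTo_cyc n).apply_mem hq, by rw [sepLetter, heq, rotate_transposition hp hq]⟩

theorem supportedUpTo_sepLetter (hn : 3 ≤ n) (j : ℕ) : SupportedUpTo n (sepLetter n j).perm := by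
  obtain ⟨p, q, hp, hq, heq⟩ := exists_sepLetter_eq hn j
  rw [heq]
  exact supportedUpTo_transposition hp hq

theorem perm_sepLetter_succ (hn : 3 ≤ n) (j : ℕ) :
    (sepLetter n (j + 1)).perm = cyc n * (sepLetter n j).perm * (cyc n)⁻¹ := by
  rw [sepLetter, perm_rotate (supportedUpTo_sepLetter hn j)]

theorem sepLetter_one (hn : 3 ≤ n) : sepLetter n 1 = transposition (n - 1) n := by
  rw [sepLetter, sepLetter, rotate_transposition (by omega) (by omega),
    cyc_of_lt (by omega) (by omega), cyc_of_lt (by omega) (by omega),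
    show n - 2 + 1 = n - 1 by omega, Nat.sub_add_cancel (by omega)]

theorem sepLetter_two (hn : 3 ≤ n) : sepLetter n 2 = transposition 1 n := by
  rw [sepLetter, sepLetter_one hn, rotate_transposition (by omega) (by omega),
    cyc_of_lt (by omega) (by omega), cyc_self (by omega), Nat.sub_add_cancel (by omega),
    transposition_comm]

theorem not_noncrossing_sepLetter_mul (hn : 3 ≤ n) (j : ℕ) :
    ¬ Noncrossing ((sepLetter n (j + 1)).perm * (sepLetter n j).perm) := by
  induction j with
  | zero =>
    rw [sepLetter_one hn, sepLetter, perm_transposition (by omega) (by omega),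
      perm_transposition (by omega) (by omega)]
    exact not_noncrossing_swap_mul_swap (by omega) (by omega)
  | succ j ih =>
    refine fun h => ih (.of_conj_cyc
      ((supportedUpTo_sepLetter hn _).mul (supportedUpTo_sepLetter hn _)) ?_)
    have hconj : cyc n * ((sepLetter n (j + 1)).perm * (sepLetter n j).perm) * (cyc n)⁻¹ =
        (sepLetter n (j + 1 + 1)).perm * (sepLetter n (j + 1)).perm := by
      rw [perm_sepLetter_succ hn (j + 1), ← conj_mul, ← perm_sepLetter_succ hn j]
    rwa [hconj]

theorem supportedWord_sepWord (hn : 3 ≤ n) (j k : ℕ) : SupportedWord n (sepWord n j k) := by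
  intro s hs
  obtain ⟨i, -, rfl⟩ := List.mem_map.1 hs
  exact supportedUpTo_sepLetter hn _

theorem sepWord_succ (n j k : ℕ) :
    sepWord n j (k + 1) = sepWord n j k ++ [sepLetter n (j + k)] := by
  rw [sepWord, List.range_succ, List.map_append, List.map_singleton, sepWord]

theorem sepWord_succ_eq_cons (n j k : ℕ) :
    sepWord n j (k + 1) = sepLetter n j :: sepWord n (j + 1) k := by
  simp only [sepWord, List.range_succ_eq_map, List.map_cons, List.map_map, Function.comp_def,
    Nat.add_zero, Nat.succ_eq_add_one, Nat.add_assoc, Nat.add_comm 1]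

theorem map_rotate_sepWord (n j k : ℕ) :
    (sepWord n j k).map (rotate n) = sepWord n (j + 1) k := by
  rw [sepWord, List.map_map]
  refine List.map_congr_left fun i _ => ?_
  rw [Nat.add_right_comm, Function.comp_apply, sepLetter]

-- The residue of a letter is below the next letter only if it is trivial, since consecutive
-- letters do not multiply to a simple element. So a letter that does not divide the first letter
-- never gets absorbed by the word.
theorem not_wordDvd_sepWord (hn : 3 ≤ n) {s : NC} {j : ℕ} (k : ℕ) (hs : ¬ s ≤ sepLetter n j) :
    ¬ WordDvd [s] (sepWord n j k) := by
  induction k generalizing j s with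
  | zero =>
    intro h
    have hs_one : s = 1 := h s (List.mem_singleton_self s)
    exact hs (hs_one ▸ NC.one_le _)
  | succ k ih =>
    intro h
    rw [sepWord_succ_eq_cons] at h
    refine ih (s := res (sepLetter n j) s) (fun hle => ?_) h
    obtain ⟨p, q, hp, hq, heq⟩ := exists_sepLetter_eq hn (j + 1)
    rw [heq] at hle
    rcases eq_one_or_eq_of_le_transposition hp.1 hq.1 hle with hres | hres
    · exact hs (NC.res_eq_one.1 hres)
    · refine not_noncrossing_sepLetter_mul hn j ?_
      rw [heq, ← hres, perm_res, inv_mul_cancel_right]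
      exact (sepLetter n j ⊔ s).noncrossing

theorem isTail_wordBraid_sepWord (hn : 3 ≤ n) {j : ℕ} (hr : 1 ≤ r)
    (hj : sepLetter n j = transposition r n) (k : ℕ) :
    IsTail n (wordBraid n (sepWord n j k)) 1 := by
  have hword := supportedWord_sepWord hn j k
  rw [isTail_one_iff (wordBraid_mem_BKL hword)]
  intro p q hp hpq hq hdvd
  rw [rightDvd_a_wordBraid_iff hp hpq hq.le hword] at hdvd
  refine not_wordDvd_sepWord hn k (fun hle => ?_) hdvd
  rw [transposition_le_iff hp (by omega), hj, perm_transposition hr (by omega)] at hle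
  have := hle.mem_of_swap hpq.ne
  omega

theorem simpleBraid_sepLetter (hn : 3 ≤ n) (j : ℕ) :
    simpleBraid n (sepLetter n j) = (φ n ^ j) (a n (n - 2) (n - 1)) := by
  induction j with
  | zero => exact simpleBraid_transposition (by omega) (by omega) (by omega)
  | succ j ih =>
    rw [φ_pow_succ_apply, ← ih, φ_simpleBraid (supportedUpTo_sepLetter hn j), sepLetter]

theorem wordBraid_sepWord_succ (hn : 3 ≤ n) (j k : ℕ) :
    wordBraid n (sepWord n j (k + 1)) =
      (φ n ^ (j + k)) (a n (n - 2) (n - 1)) * wordBraid n (sepWord n j k) := by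
  rw [sepWord_succ, wordBraid_append, wordBraid_singleton, simpleBraid_sepLetter hn]

theorem φ_wordBraid_sepWord (hn : 3 ≤ n) (j k : ℕ) :
    φ n (wordBraid n (sepWord n j k)) = wordBraid n (sepWord n (j + 1) k) := by
  rw [φ_wordBraid (supportedWord_sepWord hn j k), map_rotate_sepWord]

theorem sep_succ (n p : ℕ) : sep n (p + 1) = (φ n ^ (p + 2)) (a n (n - 2) (n - 1)) * sep n p := by
  rw [sep, List.range_succ, List.reverse_concat, List.map_cons, List.prod_cons, sep]

theorem sep_eq_wordBraid_sepWord (hn : 3 ≤ n) (p : ℕ) : sep n p = wordBraid n (sepWord n 2 p) := by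
  induction p with
  | zero => rfl
  | succ p ih => rw [wordBraid_sepWord_succ hn, ← ih, sep_succ, Nat.add_comm 2 p]

end SeparatorWord

section Separator

variable {n p : ℕ}

theorem a_ne_one {q : ℕ} (hp : 1 ≤ p) (hpq : p < q) (hq : q ≤ n) : a n p q ≠ 1 := by
  intro h
  replace h := congrArg (len n) h
  rw [len_a hp hpq hq, len_one] at h
  exact one_ne_zero h

theorem splitProd_replicate_a (hn : 3 ≤ n) (k : ℕ) :
    splitProd n (List.replicate k (a (n - 1) (n - 2) (n - 1))) = wordBraid n (sepWord n 0 k) := by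
  induction k with
  | zero => rfl
  | succ k ih =>
    rw [List.replicate_succ, splitProd, ih, wordBraid_sepWord_succ hn, List.length_replicate,
      Nat.zero_add, incl_a (by omega) (by omega) le_rfl]

theorem head?_replicate_a_ne (hn : 3 ≤ n) (k : ℕ) :
    (List.replicate k (a (n - 1) (n - 2) (n - 1))).head? ≠ some 1 := by
  cases k with
  | zero => simp
  | succ k =>
    rw [List.replicate_succ, List.head?_cons, Ne, Option.some_inj]
    exact a_ne_one (by omega) (by omega) le_rfl

theorem isSplitting_replicate_a (hn : 3 ≤ n) (k : ℕ) :
    IsSplitting n (wordBraid n (sepWord n 0 (k + 1)))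
      (List.replicate (k + 1) (a (n - 1) (n - 2) (n - 1))) := by
  have ha : a (n - 1) (n - 2) (n - 1) ∈ BKL (n - 1) := a_mem_BKL (by omega) (by omega) le_rfl
  induction k with
  | zero =>
    rw [← splitProd_replicate_a hn]
    exact isSplitting_singleton.2 ⟨ha, splitProd_singleton _ _⟩
  | succ k ih =>
    rw [← splitProd_replicate_a hn] at ih ⊢
    rw [List.replicate_succ', isSplitting_concat (by simp)]
    refine ⟨ih, head?_replicate_a_ne hn _, ha, splitProd_concat _ _ _, ?_⟩
    rw [splitProd_replicate_a hn, φ_wordBraid_sepWord hn]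
    exact isTail_wordBraid_sepWord hn (by omega) (sepLetter_one hn) _

theorem isSplitting_replicate_a_one (hn : 3 ≤ n) (k : ℕ) :
    IsSplitting n (wordBraid n (sepWord n 1 (k + 1)))
      (List.replicate (k + 1) (a (n - 1) (n - 2) (n - 1)) ++ [1]) := by
  rw [isSplitting_concat (by simp), splitProd_replicate_a hn, φ_wordBraid_sepWord hn, map_one,
    mul_one]
  exact ⟨isSplitting_replicate_a hn k, head?_replicate_a_ne hn _, one_mem _, rfl,
    isTail_wordBraid_sepWord hn (by omega) (sepLetter_one hn) _⟩

theorem isSplitting_sep (hn : 3 ≤ n) (hp : 1 ≤ p) :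
    IsSplitting n (sep n p) (List.replicate p (a (n - 1) (n - 2) (n - 1)) ++ [1, 1]) := by
  obtain ⟨k, rfl⟩ := Nat.exists_eq_add_one.2 hp
  have hsplit := isSplitting_replicate_a_one hn k
  rw [List.append_cons, sep_eq_wordBraid_sepWord hn, isSplitting_concat (by simp),
    ← hsplit.eq_splitProd, φ_wordBraid_sepWord hn, map_one, mul_one]
  exact ⟨hsplit, hsplit.head?_ne (by simp), one_mem _, rfl,
    isTail_wordBraid_sepWord hn le_rfl (sepLetter_two hn) _⟩

theorem isSplitting_a_last (hn : 3 ≤ n) :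
    IsSplitting n (a n (n - 1) n) [a (n - 1) (n - 2) (n - 1), 1] := by
  have hsplit := isSplitting_replicate_a_one hn 0
  rwa [sepWord_succ_eq_cons, sepLetter_one hn, sepWord, List.range_zero, List.map_nil,
    wordBraid_singleton, simpleBraid_transposition (by omega) (by omega) le_rfl] at hsplit

theorem hasBreadth_sep (hn : 3 ≤ n) (hp : 1 ≤ p) : HasBreadth n (sep n p) (p + 2) :=
  ⟨_, isSplitting_sep hn hp, by simp⟩

theorem Δ_eq_incl_Δ_mul (hn : 2 ≤ n) : Δ n = incl n (Δ (n - 1)) * a n (n - 1) n := by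
  have hIco : List.Ico 1 n = List.Ico 1 (n - 1) ++ [n - 1] := by
    obtain ⟨m, rfl⟩ := Nat.exists_eq_add_of_le' hn
    rw [Nat.add_succ_sub_one, List.Ico.succ_top (by omega)]
  rw [Δ, hIco, List.map_append, List.prod_append, List.map_singleton, List.prod_singleton,
    Nat.sub_add_cancel (by omega), Δ, map_list_prod, List.map_map]
  congr 2
  refine List.map_congr_left fun i hi => ?_
  rw [List.Ico.mem] at hi
  exact (incl_a (by omega) (by omega) (by omega)).symm

theorem φ_sq_a_eq (hn : 3 ≤ n) :
    (φ n ^ 2) (a n (n - 2) (n - 1)) = Δ n * (incl n (Δ (n - 1)))⁻¹ := by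
  rw [φ_pow_succ_apply, pow_one, φ_a_of_lt (by omega) (by omega) (by omega),
    show n - 2 + 1 = n - 1 by omega, Nat.sub_add_cancel (by omega), φ_apply,
    Δ_eq_incl_Δ_mul (by omega)]
  group

theorem sep_eq_Δ_pow_mul (hn : 3 ≤ n) (p : ℕ) :
    sep n p = Δ n ^ p * (incl n (Δ (n - 1)) ^ p)⁻¹ := by
  induction p with
  | zero => simp [sep]
  | succ p ih =>
    have hφ : φ n ^ p = MulAut.conj (Δ n ^ p) := by rw [φ, map_pow]
    rw [sep_succ, ih, pow_add, MulAut.mul_apply, φ_sq_a_eq hn, hφ, MulAut.conj_apply,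
      pow_succ (Δ n), pow_succ' (incl n _)]
    group

end Separator

section Minimality

variable {m p : ℕ}

theorem a_last_rotLE_of_rightDvd {x : B (m + 2)} (hx : x ∈ BKL (m + 2)) (hp : 1 ≤ p)
    (hpm : p < m + 2) (hdvd : RightDvd (m + 2) (a (m + 2) p (m + 2)) x) :
    RotLE (m + 2) (a (m + 2) (m + 1) (m + 2)) x := by
  induction m generalizing p with
  | zero =>
    obtain ⟨z, hz, rfl⟩ := hdvd
    obtain rfl : p = 1 := by omega
    obtain ⟨i, rfl⟩ := exists_eq_a_pow hz
    rcases Nat.eq_zero_or_pos i with rfl | hi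
    · exact Or.inr (one_mul _).symm
    · exact Or.inl ⟨1, i + 1, by omega, (pow_one _).symm, (pow_succ _ _).symm⟩
  | succ m ih =>
    have ha := isSplitting_a_last (n := m + 3) (by omega)
    obtain ⟨s, hs⟩ := exists_isSplitting (n := m + 3) (by omega) hx
    rcases s with _ | ⟨b, _ | ⟨c, _ | ⟨d, s⟩⟩⟩
    · exact absurd rfl hs.ne_nil
    · obtain ⟨hb, rfl⟩ := isSplitting_singleton.1 hs
      exact absurd hdvd (not_rightDvd_a_incl (n := m + 3) hp hpm hb)
    · have hb : b ≠ 1 := by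
        rintro rfl
        exact hs.head?_ne (by simp) rfl
      obtain ⟨q, hq, hqm, hdvd_b⟩ := hs.exists_rightDvd_a_last (s₁ := []) (by simp) hb
      exact ha.rotLE_of_forall₂ hs
        (.cons (ih (hs.forall_mem_BKL b (by simp)) hq hqm hdvd_b)
          (.cons (one_rotLE (hs.forall_mem_BKL c (by simp))) .nil))
    · exact Or.inl (ha.rotLT_of_length_lt hs (by simp))

theorem IsSplitting.a_last_rotLE {β : B (m + 3)} {b : B (m + 2)} {s₁ s₂ : List (B (m + 2))}
    (h : IsSplitting (m + 3) β (s₁ ++ b :: s₂)) (hs₂ : 2 ≤ s₂.length) :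
    RotLE (m + 2) (a (m + 2) (m + 1) (m + 2)) b := by
  have hb : b ≠ 1 := h.ne_one_of_two_le_length (n := m + 3) (by omega) hs₂
  obtain ⟨q, hq, hqm, hdvd⟩ := h.exists_rightDvd_a_last (n := m + 3)
    (List.ne_nil_of_length_pos (by omega)) hb
  exact a_last_rotLE_of_rightDvd (h.forall_mem_BKL b (by simp)) hq hqm hdvd

theorem forall₂_replicate_left {α β : Type*} {R : α → β → Prop} {x : α} {s : List β}
    (h : ∀ b ∈ s, R x b) : List.Forall₂ R (List.replicate s.length x) s := by
  induction s with
  | nil => exact .nil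
  | cons b s ih =>
    rw [List.forall_mem_cons] at h
    exact .cons h.1 (ih h.2)

theorem sep_rotLE {γ : B (m + 3)} (hp : 1 ≤ p) (h : HasBreadth (m + 3) γ (p + 2)) :
    RotLE (m + 3) (sep (m + 3) p) γ := by
  obtain ⟨s, hs, hlen⟩ : ∃ s : List (B (m + 2)), IsSplitting (m + 3) γ s ∧ s.length = p + 2 := h
  obtain ⟨s, b, c, rfl⟩ : ∃ (u : List (B (m + 2))) (b c : B (m + 2)), s = u ++ [b, c] := by
    obtain ⟨b, c, hbc⟩ := List.length_eq_two.1
      (show (s.drop p).length = 2 by rw [List.length_drop]; omega)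
    exact ⟨s.take p, b, c, by rw [← hbc, List.take_append_drop]⟩
  obtain rfl : s.length = p := by simpa using hlen
  refine (isSplitting_sep (by omega) hp).rotLE_of_forall₂ hs (List.rel_append
    (forall₂_replicate_left fun d hd => ?_)
    (.cons (one_rotLE (hs.forall_mem_BKL b (by simp)))
      (.cons (one_rotLE (hs.forall_mem_BKL c (by simp))) .nil)))
  obtain ⟨s₁, s₂, rfl⟩ := List.append_of_mem hd
  rw [List.append_assoc, List.cons_append] at hs
  exact hs.a_last_rotLE (by simp)

theorem sep_rotLE_of_forall {η : B (m + 3)} (hp : 1 ≤ p) (hη : η ∈ BKL (m + 3))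
    (hub : ∀ γ, (∃ r ≤ p + 1, HasBreadth (m + 3) γ r) → RotLE (m + 3) γ η) :
    RotLE (m + 3) (sep (m + 3) p) η := by
  obtain ⟨r, hr⟩ := exists_hasBreadth (by omega) hη
  rcases lt_trichotomy r (p + 2) with hlt | rfl | hlt
  · obtain ⟨γ, hγ, hηγ⟩ := hr.exists_rotLT
    exact absurd (hub γ ⟨r, Nat.le_of_lt_succ hlt, hγ⟩) (RotLT.not_rotLE (m := m + 1) hηγ)
  · exact sep_rotLE hp hr
  · exact Or.inl ((hasBreadth_sep (by omega) hp).rotLT_of_lt hr hlt)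

end Minimality

end DualBraid

theorem mainTheorem6 (n p : ℕ) (hn : 3 ≤ n) (hp : 1 ≤ p) :
    -- the splitting of the separator is `(a_{n-2,n-1}, …, a_{n-2,n-1}, 1, 1)`, of length `p + 2`
    (∀ s : List (DualBraid.B (n - 1)), DualBraid.IsSplitting n (DualBraid.sep n p) s ↔
      s = List.replicate p (DualBraid.a (n - 1) (n - 2) (n - 1)) ++ [1, 1]) ∧
    -- the separator as a quotient of powers of Garside elements
    DualBraid.sep n p =
      DualBraid.Δ n ^ p * (DualBraid.incl n (DualBraid.Δ (n - 1)) ^ p)⁻¹ ∧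
    -- the separator is the least braid with `n`-breadth `p + 2`
    (DualBraid.HasBreadth n (DualBraid.sep n p) (p + 2) ∧
      ∀ γ : DualBraid.B n, DualBraid.HasBreadth n γ (p + 2) →
        DualBraid.RotLE n (DualBraid.sep n p) γ) ∧
    -- the separator is the least upper bound of the braids with `n`-breadth at most `p + 1`
    ((∀ γ : DualBraid.B n, (∃ r ≤ p + 1, DualBraid.HasBreadth n γ r) →
        DualBraid.RotLE n γ (DualBraid.sep n p)) ∧
      ∀ η ∈ DualBraid.BKL n,
        (∀ γ : DualBraid.B n, (∃ r ≤ p + 1, DualBraid.HasBreadth n γ r) →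
          DualBraid.RotLE n γ η) →
        DualBraid.RotLE n (DualBraid.sep n p) η) := by
  obtain ⟨m, rfl⟩ := Nat.exists_eq_add_of_le' hn
  have hsplit := DualBraid.isSplitting_sep hn hp
  have hbreadth := DualBraid.hasBreadth_sep hn hp
  refine ⟨fun s => ⟨fun hs => hs.unique hsplit, fun hs => hs ▸ hsplit⟩,
    DualBraid.sep_eq_Δ_pow_mul hn p, ⟨hbreadth, fun γ => DualBraid.sep_rotLE hp⟩, ?_,
    fun η hη hub => DualBraid.sep_rotLE_of_forall hp hη hub⟩
  rintro γ ⟨r, hr, hγ⟩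
  exact Or.inl (hγ.rotLT_of_lt hbreadth (Nat.lt_succ_of_le hr))
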